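/- **Setting (Known Objective Problem).** Let $d\ge 2$, $N\ge 1$, $A\in\mathbb R^{m\times d}$, $\mathbf b\in\mathbb R^m$, $\mathbf c\in\mathbb R^d$. The objective $\mathbf c$ and the number $N$ are known to the learner; the polytope $\mathcal P=\{\mathbf x\mid A\mathbf x\le\mathbf b\}$ is not. On each day $t=1,2,\dots$ an adversary, who may choose adaptively, reveals a halfspace $\mathcal N^{(t)}=\{\mathbf x\mid \mathbf p^{(t)}\cdot\mathbf x\le b^{(t)}\}$ with $\mathbf p^{(t)}\ne 0$ and boundary hyperplane $\widetilde{\mathcal N}^{(t)}$; the learner predicts a point $\hat{\mathbf x}^{(t)}$ and then observes the maximizer $\mathbf x^{(t)}$ of $\mathbf c\cdot\mathbf x$ over $\mathcal P^{(t)}=\mathcal P\cap\mathcal N^{(t)}$. Day $t$ is a mistake if $\hat{\mathbf x}^{(t)}\ne\mathbf x^{(t)}$. A *vertex* of a polytope given by linear constraints is a point of it in which $d$ linearly independent constraint hyperplanes meet; an *edge-space* of $\mathcal P$ is a line that is the intersection of $d-1$ linearly independent constraint hyperplanes of $\mathcal P$; an *edge* is a nondegenerate segment that is the intersection of $\mathcal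 P$ with an edge-space; $E_{\mathcal P}$ is the set of edges. **Assumptions.** (1) On every day the maximizer $\mathbf x^{(t)}$ exists and is unique. (2) $\|\mathbf x\|_\infty\le 1$ for all $\mathbf x\in\mathcal P$. (3) The coordinates of every vertex of $\mathcal P$ are integer multiples of $2^{-N}$. (4) Any $d-1$ rows of $A$ are linearly independent. (5) On every day, in each vertex of $\mathcal P^{(t)}$ exactly $d$ of the $m+1$ constraints that define $\mathcal P^{(t)}$ are tight. **The algorithm LearnEdge.** LearnEdge keeps the set $X$ of the solutions observed on days with a mistake; the maximizer $\mathbf x^*$ of $\mathbf c\cdot\mathbf x$ over $\mathcal P$, once it is known; and the set $E$ of the lines that contain three different points of $X$. On each $e\in E$ it keeps a feasible interval $F_e$, which contains $\mathrm{Conv}(X\cap e)$, an infeasible region $Y_e=Y_e^0\cup Y_e^1$ consisting of the two outer ends of $e$, initially $\{\mathbf x\in e\mid\|\mathbf x\|_\infty>1\}$, and the two questionable intervals $Q_e^0,Q_e^1$ that form $e\setminus(F_e\cup Y_e)$, with midpoints $M_e^0,M_e^1$ (if $Q_e^i$ is empty, $M_e^i$ is the end of $F_e$ on that side). Points of $X$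 other than $\mathbf x^*$ on learned lines are remembered only through $F_e$. Let $\mathrm{Cand}$ consist of the points of $X\cap\widetilde{\mathcal N}^{(t)}$ that lie on no line of $E$ contained in $\widetilde{\mathcal N}^{(t)}$, together with the points in which lines of $E$ not contained in $\widetilde{\mathcal N}^{(t)}$ meet $\widetilde{\mathcal N}^{(t)}$, and let $\mathrm{Ext}\subseteq\mathrm{Cand}$ consist of those that are in $X$ or on a segment $\mathrm{Conv}(M_e^0,M_e^1)$ of such a line. *Prediction:* if $\mathbf x^*$ is known and $\mathbf x^*\in\mathcal N^{(t)}$, predict $\mathbf x^*$; else, if $\mathrm{Cand}\subseteq\bigcup_{e\in E}Y_e$ (in particular if $\mathrm{Cand}=\emptyset$), predict a point outside $\widetilde{\mathcal N}^{(t)}$; else, if $\mathrm{Ext}\ne\emptyset$, predict a point of $\mathrm{Ext}$ with the largest objective value; else predict a point of $\mathrm{Cand}$ with the smallest objective value. *Update after a mistake:* add $\mathbf x^{(t)}$ to $X$ and extend $F_e$ to $\mathbf x^{(t)}$ on each $e\in E$ with $\mathbf x^{(t)}\in e$. If $\mathbf x^{(t)}\notin\widetilde{\mathcal N}^{(t)}$,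 record $\mathbf x^*=\mathbf x^{(t)}$ and learn the new lines through $\mathbf x^{(t)}$ and two other points of $X$; else, if $\mathbf x^{(t)}$ was neither in $X$ nor on a line of $E$, learn such new lines; else, if $\mathbf c\cdot\hat{\mathbf x}^{(t)}\ge\mathbf c\cdot\mathbf x^{(t)}$, declare $\hat{\mathbf x}^{(t)}$ and all points beyond it on the line(s) $e\in E$ through it infeasible. As soon as a $Q_e^i$ is shorter than $2^{-N}$, its closure contains only one point whose coordinates are multiples of $2^{-N}$; then $F_e$ is extended up to that point, everything beyond it is declared infeasible, and $Q_e^i$ becomes empty. **Theorem.** There are an absolute constant $C$ and a polynomial $Q$ such that, for all $m$, $d\ge2$, $N\ge1$, $A,\mathbf b,\mathbf c$ and all infinite sequences of days that satisfy Assumptions (1)–(5), LearnEdge makes at most $C\,|E_{\mathcal P}|\,N\log d$ mistakes, and on each day it takes at most $Q(m,d,|E_{\mathcal P}|)$ steps, where arithmetic operations on real numbers, comparisons, roundings to an integer, and steps of loops count one each (and $2^N$ is available as a constant). -/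

import Mathlib

open scoped Matrix

noncomputable section

namespace LearnEdge

/-! ## Polytopes given by linear constraints -/

section Geometry

variable {ι : Type} {d : ℕ}

/-- The set of points that satisfy all constraints `a i ⬝ᵥ x ≤ b i`. -/
def polyhedron (a : ι → Fin d → ℝ) (b : ι → ℝ) : Set (Fin d → ℝ) :=
  {x | ∀ i, a i ⬝ᵥ x ≤ b i}

/-- A vertex: a feasible point in which `d` linearly independent constraint hyperplanes meet. -/
def IsVertex (a : ι → Fin d → ℝ) (b : ι → ℝ) (v : Fin d → ℝ) : Prop :=
  v ∈ polyhedron a b ∧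
    ∃ S : Finset ι, S.card = d ∧ LinearIndependent ℝ (fun i : S => a i) ∧
      ∀ i ∈ S, a i ⬝ᵥ v = b i

/-- The edges: the (nondegenerate) segments in which the polyhedron meets an edge-space, that is,
a line which is the intersection of `d - 1` linearly independent constraint hyperplanes. -/
def edges (a : ι → Fin d → ℝ) (b : ι → ℝ) : Set (Set (Fin d → ℝ)) :=
  {F | F.Nontrivial ∧
    ∃ S : Finset ι, S.card + 1 = d ∧ LinearIndependent ℝ (fun i : S => a i) ∧
      F = {x | ∀ i ∈ S, a i ⬝ᵥ x = b i} ∩ polyhedron a b}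

/-- The normal vectors of the constraints `a`, with the extra normal vector `p` added. -/
def addNormal (a : ι → Fin d → ℝ) (p : Fin d → ℝ) : Option ι → Fin d → ℝ
  | none => p
  | some i => a i

/-- The right-hand sides `b`, with the extra right-hand side `r` added. -/
def addBound (b : ι → ℝ) (r : ℝ) : Option ι → ℝ
  | none => r
  | some i => b i

/-- `x` is the one and only maximizer of `c ⬝ᵥ ·` over `K`. -/
def IsUniqueMax (c : Fin d → ℝ) (K : Set (Fin d → ℝ)) (x : Fin d → ℝ) : Prop :=
  x ∈ K ∧ ∀ y ∈ K, y ≠ x → c ⬝ᵥ y < c ⬝ᵥ x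

/-- All coordinates of `x` are multiples of `2⁻ᴺ`. -/
def HasPrecision (N : ℕ) (x : Fin d → ℝ) : Prop :=
  ∀ j, ∃ k : ℤ, x j = (k : ℝ) / 2 ^ N

end Geometry

/-! ## Computations with a step count

Unit-cost arithmetic on real numbers: an arithmetic operation, a comparison, a rounding to an
integer and a step of a loop over a list or over the coordinates of a vector each cost `1`.
The learner below touches numbers only through these primitives. The constants `0`, `1`, `2` and
`2 ^ N` are available to it. -/

/-- The result of a computation together with the number of steps that it took. -/
structure Cost (α : Type) where
  val : α
  time : ℕ

namespace Cost

instance : Monad Cost where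
  pure x := ⟨x, 0⟩
  bind m f := ⟨(f m.val).val, m.time + (f m.val).time⟩

@[simp] theorem val_pure {α : Type} (x : α) : (pure x : Cost α).val = x := rfl
@[simp] theorem time_pure {α : Type} (x : α) : (pure x : Cost α).time = 0 := rfl
@[simp] theorem val_bind {α β : Type} (m : Cost α) (f : α → Cost β) :
    (m >>= f).val = (f m.val).val := rfl
@[simp] theorem time_bind {α β : Type} (m : Cost α) (f : α → Cost β) :
    (m >>= f).time = m.time + (f m.val).time := rfl

/-- One step. -/
def tick : Cost Unit := ⟨(), 1⟩

/-! ### Operations on numbers -/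

def add (x y : ℝ) : Cost ℝ := ⟨x + y, 1⟩
def sub (x y : ℝ) : Cost ℝ := ⟨x - y, 1⟩
def mul (x y : ℝ) : Cost ℝ := ⟨x * y, 1⟩
def div (x y : ℝ) : Cost ℝ := ⟨x / y, 1⟩
def neg (x : ℝ) : Cost ℝ := ⟨-x, 1⟩
def ceil (x : ℝ) : Cost ℝ := ⟨(⌈x⌉ : ℝ), 1⟩
def lt (x y : ℝ) : Cost Bool := ⟨decide (x < y), 1⟩
def le (x y : ℝ) : Cost Bool := ⟨decide (x ≤ y), 1⟩
def eq (x y : ℝ) : Cost Bool := ⟨decide (x = y), 1⟩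

def min (x y : ℝ) : Cost ℝ := do
  if ← le x y then pure x else pure y

/-! ### Loops over the coordinates of a vector -/

/-- Compute a vector coordinate by coordinate. -/
def tabulate {d : ℕ} (f : Fin d → Cost ℝ) : Cost (Fin d → ℝ) :=
  ⟨fun j => (f j).val, ∑ j, ((f j).time + 1)⟩

/-- Compute a number for every coordinate and add them up. -/
def sumOver {d : ℕ} (f : Fin d → Cost ℝ) : Cost ℝ :=
  ⟨∑ j, (f j).val, ∑ j, ((f j).time + 1)⟩

/-- Perform a test for every coordinate. -/
def allOver {d : ℕ} (f : Fin d → Cost Bool) : Cost Bool :=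
  ⟨decide (∀ j, (f j).val = true), ∑ j, ((f j).time + 1)⟩

/-! ### Loops over a list -/

def fold {α β : Type} (f : β → α → Cost β) : β → List α → Cost β
  | s, [] => pure s
  | s, x :: l => do
    tick
    let s' ← f s x
    fold f s' l

def map {α β : Type} (f : α → Cost β) : List α → Cost (List β)
  | [] => pure []
  | x :: l => do
    tick
    let y ← f x
    let l' ← map f l
    pure (y :: l')

/-- The list of those values of `f` that are not `none`. -/
def filterMap {α β : Type} (f : α → Cost (Option β)) : List α → Cost (List β)
  | [] => pure []
  | x :: l => do
    tick
    let y ← f x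
    let l' ← filterMap f l
    match y with
    | none => pure l'
    | some z => pure (z :: l')

def filter {α : Type} (f : α → Cost Bool) (l : List α) : Cost (List α) :=
  filterMap (fun x => do if ← f x then pure (some x) else pure none) l

def all {α : Type} (f : α → Cost Bool) : List α → Cost Bool
  | [] => pure true
  | x :: l => do
    tick
    let y ← f x
    let z ← all f l
    pure (y && z)

def any {α : Type} (f : α → Cost Bool) : List α → Cost Bool
  | [] => pure false
  | x :: l => do
    tick
    let y ← f x
    let z ← any f l
    pure (y || z)

/-- Concatenation, one step for each entry of the first list. -/
def append {α : Type} : List α → List α → Cost (List α)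
  | [], l' => pure l'
  | x :: l, l' => do
    tick
    let l'' ← append l l'
    pure (x :: l'')

/-! ### Vectors -/

variable {d : ℕ}

def dot (x y : Fin d → ℝ) : Cost ℝ := sumOver fun j => mul (x j) (y j)

def vsub (x y : Fin d → ℝ) : Cost (Fin d → ℝ) := tabulate fun j => sub (x j) (y j)

def vneg (x : Fin d → ℝ) : Cost (Fin d → ℝ) := tabulate fun j => neg (x j)

/-- The point `x + s u`. -/
def pointAt (x u : Fin d → ℝ) (s : ℝ) : Cost (Fin d → ℝ) :=
  tabulate fun j => do
    let y ← mul s (u j)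
    add (x j) y

def veq (x y : Fin d → ℝ) : Cost Bool := allOver fun j => eq (x j) (y j)

/-- A point of maximal objective value `c ⬝ᵥ ·` in the list `x :: l`. -/
def argmax (c : Fin d → ℝ) (x : Fin d → ℝ) (l : List (Fin d → ℝ)) : Cost (Fin d → ℝ) :=
  fold (fun best y => do
    let u ← dot c best
    let v ← dot c y
    if ← lt u v then pure y else pure best) x l

/-- A point of minimal objective value `c ⬝ᵥ ·` in the list `x :: l`. -/
def argmin (c : Fin d → ℝ) (x : Fin d → ℝ) (l : List (Fin d → ℝ)) : Cost (Fin d → ℝ) := do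
  let c' ← vneg c
  argmax c' x l

end Cost

open Cost

/-! ## The information that the learner keeps -/

/-- What is known about one of the two directions along an edge-space. Positions on the edge-space
are measured in that direction. -/
structure Side where
  /-- the end of the feasible interval -/
  feas : ℝ
  /-- the position at which the certainly infeasible region begins -/
  infeas : ℝ
  /-- whether the position `infeas` itself belongs to the certainly infeasible region -/
  closed : Bool

/-- A learned edge-space, the line of all points `base + s • dir`, with what is known about it.
Direction `pos` measures the position of that point as `s`, and direction `neg` as `-s`. So the
feasible interval consists of the points with `s ≤ pos.feas` and `-s ≤ neg.feas`. The questionable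
interval of either direction is what lies between `feas` and `infeas`. -/
structure EdgeSpace (d : ℕ) where
  base : Fin d → ℝ
  dir : Fin d → ℝ
  pos : Side
  neg : Side

/-- The state of the learner. -/
structure Info (d : ℕ) where
  /-- the observed solutions (other than `opt`) that lie on no learned edge-space; those that lie on
  a learned edge-space are remembered through its feasible interval -/
  pts : List (Fin d → ℝ)
  /-- the optimal solution over the unknown polytope, if it has been observed -/
  opt : Option (Fin d → ℝ)
  /-- the learned edge-spaces -/
  lines : List (EdgeSpace d)

/-- Nothing has been observed. -/
def Info.empty (d : ℕ) : Info d := ⟨[], none, []⟩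

namespace Side

/-- The midpoint of the questionable interval. -/
def mid (S : Side) : Cost ℝ := do
  let y ← add S.feas S.infeas
  div y 2

/-- Is the position `t` in the certainly infeasible region? -/
def excludes (S : Side) (t : ℝ) : Cost Bool := do
  if S.closed then le S.infeas t else lt S.infeas t

/-- Once the questionable interval is shorter than `2⁻ᴺ`, it contains at most one point whose
coordinates are multiples of `2⁻ᴺ`, and that point is where the edge ends: the feasible interval
is extended up to it, and everything beyond it is infeasible. -/
def settle {d : ℕ} (N : ℕ) (x w : Fin d → ℝ) (S : Side) : Cost Side := do
  let ww ← dot w w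
  let q ← sub S.infeas S.feas
  let q ← mul q q
  let q ← mul q ww
  let q ← mul q (2 ^ N)
  let q ← mul q (2 ^ N)
  if ← lt q 1 then
    let y₀ ← pointAt x w S.feas
    let y₁ ← pointAt x w S.infeas
    let z ← tabulate fun j => do
      let g ← Cost.min (y₀ j) (y₁ j)
      let g ← mul g (2 ^ N)
      let g ← ceil g
      div g (2 ^ N)
    let z ← vsub z x
    let t ← dot z w
    let t ← div t ww
    pure ⟨t, t, false⟩
  else pure S

/-- The point at position `t` was found to be feasible. -/
def extend {d : ℕ} (N : ℕ) (x w : Fin d → ℝ) (S : Side) (t : ℝ) : Cost Side := do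
  if ← lt S.feas t then settle N x w ⟨t, S.infeas, S.closed⟩ else pure S

/-- The point at position `t` was found to be infeasible; if it lies in the questionable interval,
all points beyond it are infeasible, too. -/
def exclude {d : ℕ} (N : ℕ) (x w : Fin d → ℝ) (S : Side) (t : ℝ) : Cost Side := do
  if ← lt S.feas t then
    if ← le t S.infeas then settle N x w ⟨S.feas, t, true⟩ else pure S
  else pure S

/-- The largest position `t` such that `x + t w` lies in the box `[-1, 1] ^ d`
(`x` being a point of the box and `w ≠ 0`). -/
def boxEnd {d : ℕ} (x w : Fin d → ℝ) : Cost (Option ℝ) :=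
  fold (fun best j => do
    if ← eq (w j) 0 then pure best
    else
      let g ← if ← lt 0 (w j) then sub 1 (x j) else sub (-1) (x j)
      let t ← div g (w j)
      match best with
      | none => pure (some t)
      | some t' => do
        let t'' ← Cost.min t t'
        pure (some t'')) none (List.finRange d)

/-- The initial knowledge: feasible up to position `f`, infeasible outside the box. -/
def init {d : ℕ} (N : ℕ) (x w : Fin d → ℝ) (f : ℝ) : Cost Side := do
  let y ← boxEnd x w
  settle N x w ⟨f, y.getD f, false⟩

end Side

namespace EdgeSpace

variable {d : ℕ}

/-- The position of the point `x` on the edge-space, if it lies on it. -/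
def locate (e : EdgeSpace d) (x : Fin d → ℝ) : Cost (Option ℝ) := do
  let z ← vsub x e.base
  let g ← dot z e.dir
  let h ← dot e.dir e.dir
  let s ← div g h
  let y ← pointAt e.base e.dir s
  if ← veq y x then pure (some s) else pure none

def contains (e : EdgeSpace d) (x : Fin d → ℝ) : Cost Bool := do
  let s ← e.locate x
  pure s.isSome

/-- Is the point `x` in the certainly infeasible region of the edge-space? -/
def excludes (e : EdgeSpace d) (x : Fin d → ℝ) : Cost Bool := do
  match ← e.locate x with
  | none => pure false
  | some s =>
    let s' ← Cost.neg s
    let u ← e.pos.excludes s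
    let v ← e.neg.excludes s'
    pure (u || v)

/-- The point in which the edge-space crosses the hyperplane `p ⬝ᵥ x = r`, and whether it lies
between the midpoints of the two questionable intervals. An edge-space that is parallel to the
hyperplane or contained in it has no such point. -/
def cross (e : EdgeSpace d) (p : Fin d → ℝ) (r : ℝ) : Cost (Option ((Fin d → ℝ) × Bool)) := do
  let h ← dot p e.dir
  if ← eq h 0 then pure none
  else
    let g ← dot p e.base
    let g ← sub r g
    let s ← div g h
    let x ← pointAt e.base e.dir s
    let m₁ ← e.pos.mid
    let m₀ ← e.neg.mid
    let s' ← Cost.neg s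
    let u ← le s m₁
    let v ← le s' m₀
    pure (some (x, u && v))

/-- Extend the feasible interval to the feasible point `x`, if `x` lies on the edge-space. -/
def extend (N : ℕ) (x : Fin d → ℝ) (e : EdgeSpace d) : Cost (EdgeSpace d) := do
  match ← e.locate x with
  | none => pure e
  | some s =>
    let s' ← Cost.neg s
    let w ← vneg e.dir
    let pos ← e.pos.extend N e.base e.dir s
    let neg ← e.neg.extend N e.base w s'
    pure ⟨e.base, e.dir, pos, neg⟩

/-- Extend the infeasible region to the infeasible point `x`, if `x` lies on the edge-space. -/
def exclude (N : ℕ) (x : Fin d → ℝ) (e : EdgeSpace d) : Cost (EdgeSpace d) := do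
  match ← e.locate x with
  | none => pure e
  | some s =>
    let s' ← Cost.neg s
    let w ← vneg e.dir
    let pos ← e.pos.exclude N e.base e.dir s
    let neg ← e.neg.exclude N e.base w s'
    pure ⟨e.base, e.dir, pos, neg⟩

/-- The edge-space through two different feasible points. -/
def through (N : ℕ) (x y : Fin d → ℝ) : Cost (EdgeSpace d) := do
  let w ← vsub y x
  let w' ← vneg w
  let pos ← Side.init N x w 1
  let neg ← Side.init N x w' 0
  pure ⟨x, w, pos, neg⟩

end EdgeSpace

/-! ## The learner -/

section Learner

variable {d : ℕ}

/-- The prediction for the day with the new constraint `p ⬝ᵥ x ≤ r`. The list `cand` holds the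
candidates: the points of the hyperplane `p ⬝ᵥ x = r` that are observed solutions or lie on a
learned edge-space, without the learned edge-spaces that the hyperplane contains. The list `ext`
holds the candidates in the extended feasible region. -/
def predict (c : Fin d → ℝ) (I : Info d) (p : Fin d → ℝ) (r : ℝ) : Cost (Fin d → ℝ) := do
  let known ← match I.opt with
    | none => pure none
    | some y => do
      let g ← dot p y
      if ← le g r then pure (some y) else pure none
  match known with
  -- the observed optimum over the unknown polytope satisfies the new constraint
  | some y => pure y
  | none =>
    let obs ← filter (fun y => do
      let g ← dot p y
      eq g r) I.pts
    let crossings ← filterMap (fun e => e.cross p r) I.lines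
    let crossPts ← map (fun y => pure y.1) crossings
    let cand ← append obs crossPts
    let hopeless ← all (fun y => any (fun e => e.excludes y) I.lines) cand
    match hopeless, cand with
    | false, y :: l =>
      let mids ← filterMap (fun y => pure (if y.2 then some y.1 else none)) crossings
      let ext ← append obs mids
      match ext with
      -- the best point of the extended feasible region
      | z :: l' => argmax c z l'
      -- the extended feasible region has no candidate: the worst candidate
      | [] => argmin c y l
    | _, _ =>
      -- no candidate, or only certainly infeasible ones: a point off the hyperplane
      let g ← dot p p
      let h ← sub r g
      let s ← div h g
      pointAt (fun _ => 0) p s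

/-- Add all edge-spaces on which the newly observed solution `x` and two points of `l` lie, the
three of them being different. -/
def learnLines (N : ℕ) (x : Fin d → ℝ) (l : List (Fin d → ℝ)) (L : List (EdgeSpace d)) :
    Cost (List (EdgeSpace d)) :=
  fold (fun L y => fold (fun L z => do
    let xy ← veq x y
    let xz ← veq x z
    let yz ← veq y z
    if xy || xz || yz then pure L
    else
      let e ← EdgeSpace.through N x y
      let coll ← e.contains z
      let old ← any (fun e' => do
        let u ← e'.contains x
        let v ← e'.contains y
        pure (u && v)) L
      if coll && !old then
        let e ← fold (fun e y => EdgeSpace.extend N y e) e l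
        pure (e :: L)
      else pure L) L l) L l

/-- The update after a mistake: `y` was predicted and `x` is the solution. -/
def update (c : Fin d → ℝ) (N : ℕ) (I : Info d) (p : Fin d → ℝ) (r : ℝ) (y x : Fin d → ℝ) :
    Cost (Info d) := do
  let g ← dot p x
  let binds ← eq g r
  let onLine ← any (fun e => e.contains x) I.lines
  let seen ← any (fun z => veq z x) I.pts
  -- `x` becomes one of the observed solutions, so the feasible intervals grow
  let lines ← map (EdgeSpace.extend N x) I.lines
  if !binds then
    -- `x` is the optimal solution over the unknown polytope
    let lines ← learnLines N x I.pts lines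
    let pts ← filter (fun z => do
      let b ← any (fun e => e.contains z) lines
      pure (!b)) I.pts
    pure ⟨pts, some x, lines⟩
  else if !onLine && !seen then
    -- `x` is a new point on no learned edge-space
    let old ← match I.opt with
      | none => pure I.pts
      | some z => do
        tick
        pure (z :: I.pts)
    let lines ← learnLines N x old lines
    let pts ← filter (fun z => do
      let b ← any (fun e => e.contains z) lines
      pure (!b)) (x :: I.pts)
    pure ⟨pts, I.opt, lines⟩
  else
    let u ← dot c x
    let v ← dot c y
    if ← le u v then
      -- `y` is infeasible, so the infeasible region of its edge-space grows
      let lines ← map (EdgeSpace.exclude N y) lines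
      pure ⟨I.pts, I.opt, lines⟩
    else
      -- otherwise the feasible interval of the edge-space of `x` has grown
      pure ⟨I.pts, I.opt, lines⟩

/-- One day: predict, then observe the solution `x`, and update upon a mistake. The result is the
prediction and the information for the next day. -/
def day (c : Fin d → ℝ) (N : ℕ) (I : Info d) (p : Fin d → ℝ) (r : ℝ) (x : Fin d → ℝ) :
    Cost ((Fin d → ℝ) × Info d) := do
  let y ← predict c I p r
  if ← veq y x then pure (y, I)
  else
    let I' ← update c N I p r y x
    pure (y, I')

/-- The information of the learner at the beginning of day `t`, when the new constraint of day `t`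
is `p t ⬝ᵥ x ≤ r t` and its solution is `x t`. -/
def infoAt (c : Fin d → ℝ) (N : ℕ) (p : ℕ → Fin d → ℝ) (r : ℕ → ℝ) (x : ℕ → Fin d → ℝ) :
    ℕ → Info d
  | 0 => Info.empty d
  | t + 1 => (day c N (infoAt c N p r x t) (p t) (r t) (x t)).val.2

/-- The prediction on day `t`. -/
def predictionAt (c : Fin d → ℝ) (N : ℕ) (p : ℕ → Fin d → ℝ) (r : ℕ → ℝ) (x : ℕ → Fin d → ℝ)
    (t : ℕ) : Fin d → ℝ :=
  (predict c (infoAt c N p r x t) (p t) (r t)).val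

/-- The number of steps on day `t`. -/
def timeAt (c : Fin d → ℝ) (N : ℕ) (p : ℕ → Fin d → ℝ) (r : ℕ → ℝ) (x : ℕ → Fin d → ℝ)
    (t : ℕ) : ℕ :=
  (day c N (infoAt c N p r x t) (p t) (r t) (x t)).time

end Learner

end LearnEdge

end

/-!
# The mistake bound of `LearnEdge`

The solution of a day is a vertex of the polytope of that day, in which exactly `d` constraints are
tight (`solution_cases`). If the new constraint is not among them, the solution is the optimum over
the unknown polytope; this causes at most one mistake, because from then on the optimum is predicted
whenever it is feasible. Otherwise exactly `d - 1` constraints of the unknown polytope are tight at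
the solution, so that it lies in the relative interior of exactly one edge, and the new hyperplane
crosses the line of that edge transversally. Edges are therefore handled through the set of their
`d - 1` tight constraints (`edgeSupports`, at most as many as there are edges), and three different
observed points on a line always span such an edge (`exists_isEdgePoint_of_collinear`), so that every
learned line is an edge-space.

A mistake whose solution is new and on no learned line provides one of at most three points of its
edge before the line is learned (`learnLines_spec`). On any other mistake with a tight new
constraint, the solution is a candidate. If the prediction is at least as good as the solution, it
is infeasible, as it lies on the new hyperplane; if, moreover, it lies in the extended feasible
region, it excludes at least half of a questionable interval. In the remaining cases the solution is
a crossing point outside the extended feasible region, beyond the midpoint of a questionable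
interval, and it turns at least half of that interval feasible. An end of an edge is a vertex, hence
it has `N` bits of precision, and a questionable interval shorter than `2⁻ᴺ` is settled exactly
(`Side.settle_spec`). So each side of an edge is halved at most `N + O(log d)` times
(`Side.init_good`).

The potential `Info.total` adds up what may still happen on each edge, and every mistake decreases it
(`update_spec`). The same invariant bounds the number of stored points and lines by the number of
edges, from which the bound on the time of a day follows (`time_day_le`).
-/

noncomputable section

namespace LearnEdge

/-! ### Values and running times of the elementary computations -/

namespace Cost

attribute [simp] tick add sub mul div neg ceil lt le eq

section Loops

variable {α β : Type}

theorem val_min (x y : ℝ) : (Cost.min x y).val = Min.min x y := by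
  by_cases h : x ≤ y
  · simp [Cost.min, h]
  · simp [Cost.min, h, (not_le.mp h).le]

theorem time_min_le (x y : ℝ) : (Cost.min x y).time ≤ 1 := by
  simp only [Cost.min, time_bind, le, decide_eq_true_eq]
  split_ifs <;> simp

@[simp] theorem val_fold (f : β → α → Cost β) (s : β) (l : List α) :
    (fold f s l).val = l.foldl (fun s x => (f s x).val) s := by
  induction l generalizing s with
  | nil => rfl
  | cons x l ih => simp [fold, ih]

@[simp] theorem val_map (f : α → Cost β) (l : List α) :
    (map f l).val = l.map fun x => (f x).val := by
  induction l with
  | nil => rfl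
  | cons x l ih => simp [map, ih]

@[simp] theorem val_filterMap (f : α → Cost (Option β)) (l : List α) :
    (filterMap f l).val = l.filterMap fun x => (f x).val := by
  induction l with
  | nil => rfl
  | cons x l ih => cases h : (f x).val <;> simp [filterMap, ih, h]

@[simp] theorem val_filter (f : α → Cost Bool) (l : List α) :
    (filter f l).val = l.filter fun x => (f x).val := by
  induction l with
  | nil => rfl
  | cons x l ih =>
    simp only [filter, val_filterMap, val_bind] at ih ⊢
    cases h : (f x).val <;> simp [h, ih]

@[simp] theorem val_all (f : α → Cost Bool) (l : List α) :
    (all f l).val = l.all fun x => (f x).val := by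
  induction l with
  | nil => rfl
  | cons x l ih => simp [all, ih]

@[simp] theorem val_any (f : α → Cost Bool) (l : List α) :
    (any f l).val = l.any fun x => (f x).val := by
  induction l with
  | nil => rfl
  | cons x l ih => simp [any, ih]

@[simp] theorem val_append (l l' : List α) : (append l l').val = l ++ l' := by
  induction l with
  | nil => rfl
  | cons x l ih => simp [append, ih]

@[simp] theorem time_append (l l' : List α) : (append l l').time = l.length := by
  induction l with
  | nil => rfl
  | cons x l ih => simp [append, ih]; ring

theorem time_map_le {f : α → Cost β} {l : List α} {k : ℕ} (h : ∀ x ∈ l, (f x).time ≤ k) :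
    (map f l).time ≤ l.length * (k + 1) := by
  induction l with
  | nil => simp [map]
  | cons x l ih =>
    have h₁ := h x (by simp)
    have h₂ := ih fun y hy => h y (by simp [hy])
    simp only [map, tick, time_bind, time_pure, List.length_cons]
    linarith

theorem time_filterMap_le {f : α → Cost (Option β)} {l : List α} {k : ℕ}
    (h : ∀ x ∈ l, (f x).time ≤ k) : (filterMap f l).time ≤ l.length * (k + 1) := by
  induction l with
  | nil => simp [filterMap]
  | cons x l ih =>
    have h₁ := h x (by simp)
    have h₂ := ih fun y hy => h y (by simp [hy])
    cases h₃ : (f x).val <;>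
      simp only [filterMap, tick, time_bind, h₃, time_pure, List.length_cons] <;> linarith

theorem time_filter_le {f : α → Cost Bool} {l : List α} {k : ℕ}
    (h : ∀ x ∈ l, (f x).time ≤ k) : (filter f l).time ≤ l.length * (k + 1) := by
  refine time_filterMap_le fun x hx => ?_
  have := h x hx
  cases h₃ : (f x).val <;> simpa [h₃] using this

theorem time_all_le {f : α → Cost Bool} {l : List α} {k : ℕ}
    (h : ∀ x ∈ l, (f x).time ≤ k) : (all f l).time ≤ l.length * (k + 1) := by
  induction l with
  | nil => simp [all]
  | cons x l ih =>
    have h₁ := h x (by simp)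
    have h₂ := ih fun y hy => h y (by simp [hy])
    simp only [all, tick, time_bind, time_pure, List.length_cons]
    linarith

theorem time_any_le {f : α → Cost Bool} {l : List α} {k : ℕ}
    (h : ∀ x ∈ l, (f x).time ≤ k) : (any f l).time ≤ l.length * (k + 1) := by
  induction l with
  | nil => simp [any]
  | cons x l ih =>
    have h₁ := h x (by simp)
    have h₂ := ih fun y hy => h y (by simp [hy])
    simp only [any, tick, time_bind, time_pure, List.length_cons]
    linarith

theorem time_fold_le {f : β → α → Cost β} {s : β} {l : List α} {k : ℕ}
    (h : ∀ s x, (f s x).time ≤ k) : (fold f s l).time ≤ l.length * (k + 1) := by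
  induction l generalizing s with
  | nil => simp [fold]
  | cons x l ih =>
    have h₁ := h s x
    have h₂ := ih (s := (f s x).val)
    simp only [fold, tick, time_bind, List.length_cons]
    linarith

theorem val_fold_le_of_growth {f : β → α → Cost β} (μ : β → ℕ) {s : β} {l : List α} {a : ℕ}
    (hμ : ∀ s x, μ (f s x).val ≤ μ s + a) : μ (fold f s l).val ≤ μ s + l.length * a := by
  induction l generalizing s with
  | nil => simp [fold]
  | cons x l ih =>
    have h₀ := hμ s x
    have h₂ := ih (s := (f s x).val)
    simp only [fold, val_bind, List.length_cons]
    linarith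

/-- A loop in which the size `μ` of the state, which governs the cost of a step, grows by at most
`a` in each step: `M` bounds the size throughout, and `k` the cost of a step at that size. -/
theorem time_fold_le_of_growth {f : β → α → Cost β} (μ : β → ℕ) {s : β} {l : List α} {k a M : ℕ}
    (hμ : ∀ s x, μ (f s x).val ≤ μ s + a) (h : ∀ s x, μ s ≤ M → (f s x).time ≤ k)
    (hM : μ s + l.length * a ≤ M) :
    (fold f s l).time ≤ l.length * (k + 1) := by
  induction l generalizing s with
  | nil => simp [fold]
  | cons x l ih =>
    simp only [List.length_cons] at hM ⊢
    have h₀ := hμ s x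
    have h₁ := h s x (by linarith [Nat.zero_le ((l.length + 1) * a)])
    have h₂ := ih (s := (f s x).val) (by linarith)
    simp only [fold, tick, time_bind]
    linarith

end Loops

variable {d : ℕ}

@[simp] theorem val_dot (x y : Fin d → ℝ) : (dot x y).val = x ⬝ᵥ y := rfl
@[simp] theorem val_vsub (x y : Fin d → ℝ) : (vsub x y).val = x - y := rfl
@[simp] theorem val_vneg (x : Fin d → ℝ) : (vneg x).val = -x := rfl

@[simp] theorem val_pointAt (x u : Fin d → ℝ) (s : ℝ) : (pointAt x u s).val = x + s • u := rfl

@[simp] theorem val_veq (x y : Fin d → ℝ) : (veq x y).val = decide (x = y) := by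
  simp [veq, allOver, funext_iff]

@[simp] theorem time_dot (x y : Fin d → ℝ) : (dot x y).time = 2 * d := by
  simp [dot, sumOver]; ring
@[simp] theorem time_vsub (x y : Fin d → ℝ) : (vsub x y).time = 2 * d := by
  simp [vsub, tabulate]; ring
@[simp] theorem time_vneg (x : Fin d → ℝ) : (vneg x).time = 2 * d := by
  simp [vneg, tabulate]; ring
@[simp] theorem time_veq (x y : Fin d → ℝ) : (veq x y).time = 2 * d := by
  simp [veq, allOver]; ring
@[simp] theorem time_pointAt (x u : Fin d → ℝ) (s : ℝ) : (pointAt x u s).time = 3 * d := by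
  simp [pointAt, tabulate]; ring

theorem argmax_spec (c x : Fin d → ℝ) (l : List (Fin d → ℝ)) :
    (argmax c x l).val ∈ x :: l ∧ ∀ y ∈ x :: l, c ⬝ᵥ y ≤ c ⬝ᵥ (argmax c x l).val := by
  induction l generalizing x with
  | nil => simp [argmax, fold]
  | cons z l ih =>
    have key : (argmax c x (z :: l)).val
        = (argmax c (if c ⬝ᵥ x < c ⬝ᵥ z then z else x) l).val := by
      simp only [argmax, val_fold, List.foldl_cons]
      congr 1
      by_cases h : c ⬝ᵥ x < c ⬝ᵥ z <;> simp [h]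
    rw [key]
    split_ifs with h
    · obtain ⟨h₁, h₂⟩ := ih z
      refine ⟨List.mem_cons_of_mem _ h₁, fun y hy => ?_⟩
      rcases List.mem_cons.mp hy with rfl | hy
      · exact h.le.trans (h₂ z (by simp))
      · exact h₂ y hy
    · obtain ⟨h₁, h₂⟩ := ih x
      constructor
      · rcases List.mem_cons.mp h₁ with h₁ | h₁ <;> simp [h₁]
      · intro y hy
        rcases List.mem_cons.mp hy with rfl | hy
        · exact h₂ y (by simp)
        · rcases List.mem_cons.mp hy with rfl | hy
          · exact (not_lt.mp h).trans (h₂ x (by simp))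
          · exact h₂ y (by simp [hy])

theorem argmin_spec (c x : Fin d → ℝ) (l : List (Fin d → ℝ)) :
    (argmin c x l).val ∈ x :: l ∧ ∀ y ∈ x :: l, c ⬝ᵥ (argmin c x l).val ≤ c ⬝ᵥ y := by
  obtain ⟨h₁, h₂⟩ := argmax_spec (-c) x l
  refine ⟨h₁, fun y hy => ?_⟩
  have := h₂ y hy
  rw [neg_dotProduct, neg_dotProduct] at this
  exact neg_le_neg_iff.mp this

theorem time_argmax_le (c x : Fin d → ℝ) (l : List (Fin d → ℝ)) :
    (argmax c x l).time ≤ l.length * (4 * d + 2) := by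
  refine time_fold_le fun s y => ?_
  simp only [time_bind, time_dot, val_dot, lt]
  split_ifs <;> simp <;> omega

theorem time_argmin_le (c x : Fin d → ℝ) (l : List (Fin d → ℝ)) :
    (argmin c x l).time ≤ 2 * d + l.length * (4 * d + 2) := by
  simpa [argmin] using time_argmax_le (-c) x l

end Cost

/-! ### Running times of the learner -/

section Times

open Cost

variable {d : ℕ}

theorem Side.time_mid (S : Side) : S.mid.time = 2 := rfl

theorem Side.time_excludes_le (S : Side) (t : ℝ) : (S.excludes t).time ≤ 1 := by
  unfold Side.excludes; split_ifs <;> simp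

theorem Side.time_settle_le (N : ℕ) (x w : Fin d → ℝ) (S : Side) :
    (S.settle N x w).time ≤ 17 * d + 10 := by
  have h : ∀ f g : Fin d → ℝ, (tabulate fun j => do
        let g ← Cost.min (f j) (g j)
        let g ← mul g (2 ^ N)
        let g ← ceil g
        div g (2 ^ N)).time ≤ d * 5 := by
    intro f g
    refine (Finset.sum_le_card_nsmul (Finset.univ : Finset (Fin d)) _ 5 fun j _ => ?_).trans
      (by simp)
    have := time_min_le (f j) (g j)
    simp; omega
  simp only [Side.settle, time_bind]
  split_ifs
  · have := h (pointAt x w S.feas).val (pointAt x w S.infeas).val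
    simp only [time_bind, time_dot, time_pointAt, time_vsub, sub, mul, lt, div, time_pure]
      at this ⊢
    linarith
  · simp; omega

theorem Side.time_extend_le (N : ℕ) (x w : Fin d → ℝ) (S : Side) (t : ℝ) :
    (S.extend N x w t).time ≤ 17 * d + 11 := by
  simp only [Side.extend, time_bind, lt]
  split_ifs
  · have := Side.time_settle_le N x w ⟨t, S.infeas, S.closed⟩
    omega
  · simp

theorem Side.time_exclude_le (N : ℕ) (x w : Fin d → ℝ) (S : Side) (t : ℝ) :
    (S.exclude N x w t).time ≤ 17 * d + 12 := by
  simp only [Side.exclude, time_bind, lt, le]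
  split_ifs
  · have := Side.time_settle_le N x w ⟨S.feas, t, true⟩
    simp only [time_bind]
    split_ifs
    · omega
    · simp
  · simp

theorem Side.time_boxEnd_le (x w : Fin d → ℝ) : (Side.boxEnd x w).time ≤ d * 6 := by
  refine (time_fold_le (k := 5) fun best j => ?_).trans (by simp)
  simp only [time_bind, eq]
  split_ifs
  · simp
  · cases best with
    | none => simp only [lt, time_bind]; split_ifs <;> simp
    | some t =>
      have h₁ := time_min_le ((1 - x j) / w j) t
      have h₂ := time_min_le ((-1 - x j) / w j) t
      simp only [lt, time_bind]
      split_ifs <;> simp <;> omega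

theorem Side.time_init_le (N : ℕ) (x w : Fin d → ℝ) (f : ℝ) :
    (Side.init N x w f).time ≤ 23 * d + 10 := by
  have h₁ := Side.time_boxEnd_le x w
  have h₂ := Side.time_settle_le N x w ⟨f, (Side.boxEnd x w).val.getD f, false⟩
  simp only [Side.init, time_bind]
  omega

namespace EdgeSpace

theorem time_locate_le (e : EdgeSpace d) (x : Fin d → ℝ) : (e.locate x).time ≤ 11 * d + 1 := by
  simp only [locate, time_bind, time_vsub, time_dot, time_pointAt, time_veq]
  split_ifs <;> simp <;> omega

theorem time_contains_le (e : EdgeSpace d) (x : Fin d → ℝ) :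
    (e.contains x).time ≤ 11 * d + 1 := by
  simpa [contains] using time_locate_le e x

theorem time_excludes_le (e : EdgeSpace d) (x : Fin d → ℝ) :
    (e.excludes x).time ≤ 11 * d + 4 := by
  have h₁ := time_locate_le e x
  simp only [excludes, time_bind]
  cases (e.locate x).val with
  | none => simp; omega
  | some s =>
    have h₂ := e.pos.time_excludes_le s
    have h₃ := e.neg.time_excludes_le (-s)
    simp; omega

theorem time_cross_le (e : EdgeSpace d) (p : Fin d → ℝ) (r : ℝ) :
    (e.cross p r).time ≤ 7 * d + 11 := by
  simp only [cross, time_bind, eq, time_dot]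
  split_ifs
  · simp; omega
  · simp [Side.time_mid]; omega

theorem time_extend_le (N : ℕ) (x : Fin d → ℝ) (e : EdgeSpace d) :
    (e.extend N x).time ≤ 47 * d + 24 := by
  have h₁ := time_locate_le e x
  simp only [extend, time_bind]
  cases (e.locate x).val with
  | none => simp; omega
  | some s =>
    have h₂ := e.pos.time_extend_le N e.base e.dir s
    have h₃ := e.neg.time_extend_le N e.base (-e.dir) (-s)
    simp; omega

theorem time_exclude_le (N : ℕ) (x : Fin d → ℝ) (e : EdgeSpace d) :
    (e.exclude N x).time ≤ 47 * d + 26 := by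
  have h₁ := time_locate_le e x
  simp only [exclude, time_bind]
  cases (e.locate x).val with
  | none => simp; omega
  | some s =>
    have h₂ := e.pos.time_exclude_le N e.base e.dir s
    have h₃ := e.neg.time_exclude_le N e.base (-e.dir) (-s)
    simp; omega

theorem time_through_le (N : ℕ) (x y : Fin d → ℝ) :
    (through N x y).time ≤ 50 * d + 20 := by
  have h₁ := Side.time_init_le N x (y - x) 1
  have h₂ := Side.time_init_le N x (-(y - x)) 0
  simp only [through, time_bind, time_vsub, val_vsub, time_vneg, val_vneg, time_pure]
  omega

end EdgeSpace

end Times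

section DayTime

open Cost

variable {d : ℕ}

/-- The number of steps of `learnLines` for `n` points and `l` learned edge-spaces in dimension `d`,
as a polynomial expression. The expressions for the running times are defined over any commutative
semiring, so that they can be read as numbers and as polynomials. -/
def learnBound {R : Type} [CommSemiring R] (d n l : R) : R :=
  n * (n * (67 * d + 21 + (l + n * n + n) * (22 * d + 3) + n * (47 * d + 25) + 1) + 1)

/-- The number of steps of `predict`. -/
def predictBound {R : Type} [CommSemiring R] (d n l : R) : R :=
  10 * d + 10 + n * (2 * d + 4) + l * (7 * d + 14) + (n + l) * (l * (11 * d + 5) + 1)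
    + (n + l) * (4 * d + 2)

/-- The number of steps of `update`. -/
def updateBound {R : Type} [CommSemiring R] (d n l : R) : R :=
  10 * d + 10 + n * (2 * d + 1) + l * (105 * d + 60) + learnBound d (n + 1) l
    + (n + 1) * ((l + (n + 1) * (n + 1)) * (11 * d + 2) + 1)

/-- The number of steps of one day. -/
def dayBound {R : Type} [CommSemiring R] (d n l : R) : R :=
  predictBound d n l + 2 * d + updateBound d n l

theorem dayBound_mono {d n n' l l' : ℕ} (hn : n ≤ n') (hl : l ≤ l') :
    dayBound d n l ≤ dayBound d n' l' := by
  unfold dayBound predictBound updateBound learnBound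
  gcongr

/-- The prediction on a day on which no known optimum is available. -/
def predictUnknown (c : Fin d → ℝ) (I : Info d) (p : Fin d → ℝ) (r : ℝ) : Cost (Fin d → ℝ) := do
  let obs ← filter (fun y => do
    let g ← dot p y
    eq g r) I.pts
  let crossings ← filterMap (fun e => e.cross p r) I.lines
  let crossPts ← map (fun y => pure y.1) crossings
  let cand ← append obs crossPts
  let hopeless ← all (fun y => any (fun e => e.excludes y) I.lines) cand
  match hopeless, cand with
  | false, y :: l =>
    let mids ← filterMap (fun y => pure (if y.2 then some y.1 else none)) crossings
    let ext ← append obs mids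
    match ext with
    | z :: l' => argmax c z l'
    | [] => argmin c y l
  | _, _ =>
    let g ← dot p p
    let h ← sub r g
    let s ← div h g
    pointAt (fun _ => 0) p s

theorem val_predict (c : Fin d → ℝ) (I : Info d) (p : Fin d → ℝ) (r : ℝ) :
    (predict c I p r).val = match I.opt with
      | none => (predictUnknown c I p r).val
      | some y => if p ⬝ᵥ y ≤ r then y else (predictUnknown c I p r).val := by
  unfold predict
  cases I.opt with
  | none => rfl
  | some y =>
    simp only [val_bind, le]
    by_cases h : p ⬝ᵥ y ≤ r
    · rw [if_pos h, if_pos (decide_eq_true (show (dot p y).val ≤ r from h))]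
      rfl
    · rw [if_neg h, if_neg fun h' => h (of_decide_eq_true (p := (dot p y).val ≤ r) h')]
      rfl

theorem time_predict_le_add (c : Fin d → ℝ) (I : Info d) (p : Fin d → ℝ) (r : ℝ) :
    (predict c I p r).time ≤ 2 * d + 1 + (predictUnknown c I p r).time := by
  unfold predict
  cases I.opt with
  | none => exact le_of_eq_of_le (Nat.zero_add _) (Nat.le_add_left _ _)
  | some y =>
    simp only [time_bind, time_dot, le]
    split_ifs
    · simp
    · refine le_of_eq_of_le (?_ : _ = 2 * d + (1 + (0 + (predictUnknown c I p r).time))) (by omega)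
      rfl

theorem time_predict_le (c : Fin d → ℝ) (I : Info d) (p : Fin d → ℝ) (r : ℝ) :
    (predict c I p r).time ≤ predictBound d I.pts.length I.lines.length := by
  set n := I.pts.length with hn
  set l := I.lines.length with hl
  have h₁ : (filter (fun y => do let g ← dot p y; eq g r) I.pts).time ≤ n * (2 * d + 2) :=
    time_filter_le fun y _ => by simp
  have h₂ : (filterMap (fun e : EdgeSpace d => e.cross p r) I.lines).time ≤ l * (7 * d + 12) :=
    time_filterMap_le fun e _ => e.time_cross_le p r
  set obs := (filter (fun y => do let g ← dot p y; eq g r) I.pts).val with hobs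
  set cr := (filterMap (fun e : EdgeSpace d => e.cross p r) I.lines).val with hcr
  have h₃ : obs.length ≤ n := by
    rw [hobs, val_filter]; exact List.length_filter_le _ _
  have h₄ : cr.length ≤ l := by
    rw [hcr, val_filterMap]; exact List.length_filterMap_le _ _
  have h₅ : (map (fun y : (Fin d → ℝ) × Bool => (pure y.1 : Cost (Fin d → ℝ))) cr).time ≤ l :=
    (time_map_le (k := 0) fun _ _ => le_rfl).trans (by simpa using h₄)
  have h₆ : ∀ cand : List (Fin d → ℝ), cand.length ≤ n + l →
      (all (fun y => any (fun e : EdgeSpace d => e.excludes y) I.lines) cand).time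
        ≤ (n + l) * (l * (11 * d + 5) + 1) := fun cand h =>
    (time_all_le fun y _ => time_any_le fun e _ => e.time_excludes_le y).trans
      (Nat.mul_le_mul_right _ h)
  have h₇ : (filterMap (fun y : (Fin d → ℝ) × Bool =>
      (pure (if y.2 then some y.1 else none) : Cost (Option (Fin d → ℝ)))) cr).time ≤ l :=
    (time_filterMap_le (k := 0) fun _ _ => le_rfl).trans (by simpa using h₄)
  refine (time_predict_le_add c I p r).trans ?_
  have hmain : (predictUnknown c I p r).time ≤ n * (2 * d + 2) + (l * (7 * d + 12) + (l + (n +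
      ((n + l) * (l * (11 * d + 5) + 1) + (n + l + (5 * d + 2) + (n + l) * (4 * d + 2)))))) := by
    unfold predictUnknown
    simp only [time_bind, ← hobs, ← hcr, time_append]
    set cand := (append obs (map (fun y : (Fin d → ℝ) × Bool =>
      (pure y.1 : Cost (Fin d → ℝ))) cr).val).val with hcand
    have hc : cand.length ≤ n + l := by
      simp [hcand]; omega
    have h₈ := h₆ cand hc
    set hope := all (fun y => any (fun e : EdgeSpace d => e.excludes y) I.lines) cand
    have hoff : 2 * d + (1 + (1 + 3 * d)) ≤ 5 * d + 2 + (n + l) * (4 * d + 2) := by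
      omega
    have hrest : (match hope.val, cand with
      | false, y :: l => do
        let mids ← filterMap (fun y : (Fin d → ℝ) × Bool =>
          (pure (if y.2 then some y.1 else none) : Cost (Option (Fin d → ℝ)))) cr
        let ext ← append obs mids
        match ext with
        | z :: l' => argmax c z l'
        | [] => argmin c y l
      | _, _ => do
        let g ← dot p p
        let h ← sub r g
        let s ← div h g
        pointAt (fun _ => 0) p s).time ≤ n + l + (5 * d + 2) + (n + l) * (4 * d + 2) := by
      split
      · rename_i y t _ hce
        simp only [time_bind, time_append]
        set mids := (filterMap (fun y : (Fin d → ℝ) × Bool =>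
          (pure (if y.2 then some y.1 else none) : Cost (Option (Fin d → ℝ)))) cr).val with hm
        have hm' : mids.length ≤ l := by
          rw [hm, val_filterMap]; exact (List.length_filterMap_le _ _).trans h₄
        split
        · rename_i z l' he
          have hle : l'.length ≤ n + l := by
            have := congrArg List.length he
            simp at this; omega
          have := (time_argmax_le c z l').trans (Nat.mul_le_mul_right _ hle)
          omega
        · have hle : t.length ≤ n + l := by
            rw [hce] at hc; simp at hc; omega
          have h₀ := time_argmin_le c y t
          have := Nat.mul_le_mul_right (4 * d + 2) hle
          omega
      · simp only [time_bind, time_dot, sub, div, time_pointAt]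
        omega
    exact Nat.add_le_add h₁ (Nat.add_le_add h₂ (Nat.add_le_add h₅
      (Nat.add_le_add h₃ (Nat.add_le_add h₈ hrest))))
  unfold predictBound
  linarith

/-- The step of `learnLines` for two previously observed points `y` and `z`. -/
def learnStep (N : ℕ) (x : Fin d → ℝ) (l : List (Fin d → ℝ)) (y : Fin d → ℝ)
    (L : List (EdgeSpace d)) (z : Fin d → ℝ) : Cost (List (EdgeSpace d)) := do
  let xy ← veq x y
  let xz ← veq x z
  let yz ← veq y z
  if xy || xz || yz then pure L
  else
    let e ← EdgeSpace.through N x y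
    let coll ← e.contains z
    let old ← any (fun e' => do
      let u ← e'.contains x
      let v ← e'.contains y
      pure (u && v)) L
    if coll && !old then
      let e ← fold (fun e y => EdgeSpace.extend N y e) e l
      pure (e :: L)
    else pure L

theorem learnLines_eq (N : ℕ) (x : Fin d → ℝ) (l : List (Fin d → ℝ)) (L : List (EdgeSpace d)) :
    learnLines N x l L = fold (fun L y => fold (learnStep N x l y) L l) L l := rfl

theorem time_learnLines_le (N : ℕ) (x : Fin d → ℝ) (l : List (Fin d → ℝ))
    (L : List (EdgeSpace d)) :
    (learnLines N x l L).time ≤ learnBound d l.length L.length ∧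
      (learnLines N x l L).val.length ≤ L.length + l.length * l.length := by
  set n := l.length with hn
  set M := L.length + n * n with hM
  set k := 67 * d + 21 + (M + n) * (22 * d + 3) + n * (47 * d + 25) with hk
  set f := learnStep N x l with hf
  have hgrow : ∀ y L z, (f y L z).val.length ≤ L.length + 1 := by
    intro y L z
    simp only [hf, learnStep, val_bind]
    split_ifs
    · simp
    · simp only [val_bind]
      split_ifs <;> simp
  have hcost : ∀ y L z, L.length ≤ M + n → (f y L z).time ≤ k := by
    intro y L z hL
    simp only [hf, learnStep, time_bind, time_veq]
    split_ifs
    · simp; omega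
    · have h₁ := EdgeSpace.time_through_le N x y
      have h₂ := (EdgeSpace.through N x y).val.time_contains_le z
      have h₃ : (any (fun e' : EdgeSpace d => do
          let u ← e'.contains x
          let v ← e'.contains y
          pure (u && v)) L).time ≤ (M + n) * (22 * d + 3) := by
        refine (time_any_le (k := 22 * d + 2) fun e _ => ?_).trans (Nat.mul_le_mul_right _ hL)
        have h₄ := e.time_contains_le x
        have h₅ := e.time_contains_le y
        simp; omega
      have h₆ : (fold (fun e y => EdgeSpace.extend N y e) (EdgeSpace.through N x y).val l).time
          ≤ n * (47 * d + 25) := time_fold_le fun e y => e.time_extend_le N y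
      simp only [time_bind]
      split_ifs <;> simp <;> omega
  have hinner : ∀ L y, L.length ≤ M →
      (fold (f y) L l).time ≤ n * (k + 1) := fun L y hL =>
    time_fold_le_of_growth List.length (hgrow y) (hcost y) (M := M + n) (by omega)
  have hinner' : ∀ L y, (fold (f y) L l).val.length ≤ L.length + n := fun L y => by
    simpa using val_fold_le_of_growth (f := f y) (s := L) (l := l) List.length (hgrow y)
  rw [learnLines_eq]
  refine ⟨(time_fold_le_of_growth (f := fun L y => fold (f y) L l) (s := L) (l := l)
    List.length hinner' hinner le_rfl).trans (le_of_eq ?_),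
    val_fold_le_of_growth (f := fun L y => fold (f y) L l) (s := L) (l := l)
    List.length hinner'⟩
  simp only [learnBound, ← hn, hk, hM]

theorem time_update_le (c : Fin d → ℝ) (N : ℕ) (I : Info d) (p : Fin d → ℝ) (r : ℝ)
    (y x : Fin d → ℝ) :
    (update c N I p r y x).time ≤ updateBound d I.pts.length I.lines.length := by
  set n := I.pts.length with hn
  set l := I.lines.length with hl
  have h₁ : (any (fun e : EdgeSpace d => e.contains x) I.lines).time ≤ l * (11 * d + 2) :=
    time_any_le fun e _ => e.time_contains_le x
  have h₂ : (any (fun z => veq z x) I.pts).time ≤ n * (2 * d + 1) :=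
    time_any_le fun z _ => by simp
  have h₃ : (map (EdgeSpace.extend N x) I.lines).time ≤ l * (47 * d + 25) :=
    time_map_le fun e _ => e.time_extend_le N x
  have hlen : (map (EdgeSpace.extend N x) I.lines).val.length = l := by simp [hl]
  have hmono : ∀ n', n' ≤ n + 1 → learnBound d n' l ≤ learnBound d (n + 1) l := by
    intro n' h
    unfold learnBound
    gcongr
  have hfilter : ∀ (pts old : List (Fin d → ℝ)), pts.length ≤ n + 1 → old.length ≤ n + 1 →
      (filter (fun z => do
        let b ← any (fun e : EdgeSpace d => e.contains z)
          (learnLines N x old (map (EdgeSpace.extend N x) I.lines).val).val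
        pure (!b)) pts).time ≤ (n + 1) * ((l + (n + 1) * (n + 1)) * (11 * d + 2) + 1) := by
    intro pts old h h'
    refine (time_filter_le (k := (l + (n + 1) * (n + 1)) * (11 * d + 2)) fun z _ => ?_).trans
      (Nat.mul_le_mul_right _ h)
    have h₄ := (time_learnLines_le N x old (map (EdgeSpace.extend N x) I.lines).val).2
    rw [hlen] at h₄
    have h₅ : (any (fun e : EdgeSpace d => e.contains z)
          (learnLines N x old (map (EdgeSpace.extend N x) I.lines).val).val).time ≤ _ :=
      time_any_le fun e _ => e.time_contains_le z
    simp only [time_bind, time_pure, add_zero]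
    refine h₅.trans (Nat.mul_le_mul_right _ (h₄.trans ?_))
    gcongr
  have hlearn : ∀ old : List (Fin d → ℝ), old.length ≤ n + 1 →
      (learnLines N x old (map (EdgeSpace.extend N x) I.lines).val).time
        ≤ learnBound d (n + 1) l := fun old h => by
    have := (time_learnLines_le N x old (map (EdgeSpace.extend N x) I.lines).val).1
    rw [hlen] at this
    exact this.trans (hmono _ h)
  simp only [update, time_bind, time_dot, eq]
  unfold updateBound
  have hL := Nat.zero_le (learnBound d (n + 1) l)
  have hF := Nat.zero_le ((n + 1) * ((l + (n + 1) * (n + 1)) * (11 * d + 2) + 1))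
  have hld := Nat.zero_le (l * d)
  split_ifs
  · have h₄ := hlearn I.pts (by omega)
    have h₅ := hfilter I.pts I.pts (by omega) (by omega)
    simp only [time_bind, time_pure] at h₅ ⊢
    nlinarith
  · cases I.opt with
    | none =>
      have h₄ := hlearn I.pts (by omega)
      have h₅ := hfilter (x :: I.pts) I.pts (by simp [hn]) (by omega)
      simp only [val_pure, time_bind, time_pure] at h₅ ⊢
      linarith
    | some z =>
      have h₄ := hlearn (z :: I.pts) (by simp [hn])
      have h₅ := hfilter (x :: I.pts) (z :: I.pts) (by simp [hn]) (by simp [hn])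
      simp only [tick, val_pure, time_bind, time_pure] at h₅ ⊢
      linarith
  · have h₄ : (map (EdgeSpace.exclude N y) (map (EdgeSpace.extend N x) I.lines).val).time
        ≤ l * (47 * d + 27) := by
      rw [← hlen]
      exact time_map_le fun e _ => e.time_exclude_le N y
    simp only [time_bind, le]
    split_ifs
    · simp only [time_bind, time_pure, time_dot]
      linarith
    · simp only [time_pure, time_dot]
      linarith

theorem time_day_le (c : Fin d → ℝ) (N : ℕ) (I : Info d) (p : Fin d → ℝ) (r : ℝ)
    (x : Fin d → ℝ) :
    (day c N I p r x).time ≤ dayBound d I.pts.length I.lines.length := by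
  have h₁ := time_predict_le c I p r
  have h₂ := time_update_le c N I p r (predict c I p r).val x
  simp only [day, time_bind, time_veq]
  unfold dayBound
  split_ifs
  · simp; omega
  · simp only [time_bind, time_pure]; omega

end DayTime

/-! ### Geometry of polyhedra -/

section Polyhedra

open Filter Topology

variable {ι : Type} {d : ℕ} {a : ι → Fin d → ℝ} {b : ι → ℝ} {x : Fin d → ℝ}

/-- The constraints that are tight at `x` determine `x`: no direction is orthogonal to all of their
normal vectors. -/
def Pinned (a : ι → Fin d → ℝ) (b : ι → ℝ) (x : Fin d → ℝ) : Prop :=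
  ∀ u, (∀ i, a i ⬝ᵥ x = b i → a i ⬝ᵥ u = 0) → u = 0

theorem eventually_dotProduct_lt {p u : Fin d → ℝ} {r : ℝ} (h : p ⬝ᵥ x < r) :
    ∀ᶠ s in 𝓝[>] (0 : ℝ), p ⬝ᵥ (x + s • u) < r := by
  have : Tendsto (fun s : ℝ => p ⬝ᵥ (x + s • u)) (𝓝[>] 0) (𝓝 (p ⬝ᵥ x)) := by
    refine Tendsto.mono_left ?_ nhdsWithin_le_nhds
    refine Continuous.tendsto' ?_ _ _ (by simp)
    simp only [dotProduct_add, dotProduct_smul]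
    fun_prop
  exact this.eventually_lt_const h

theorem eventually_mem_polyhedron [Finite ι] (hx : x ∈ polyhedron a b) {u : Fin d → ℝ}
    (hu : ∀ i, a i ⬝ᵥ x = b i → a i ⬝ᵥ u ≤ 0) :
    ∀ᶠ s in 𝓝[>] (0 : ℝ), x + s • u ∈ polyhedron a b := by
  refine eventually_all.mpr fun i => ?_
  rcases (hx i).eq_or_lt with h | h
  · filter_upwards [self_mem_nhdsWithin] with s (hs : 0 < s)
    rw [dotProduct_add, dotProduct_smul, h, smul_eq_mul]
    nlinarith [hu i h]
  · exact (eventually_dotProduct_lt h).mono fun s hs => hs.le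

theorem IsUniqueMax.pinned [Finite ι] {c : Fin d → ℝ} (h : IsUniqueMax c (polyhedron a b) x) :
    Pinned a b x := by
  intro u hu
  by_contra hne
  have h₁ := eventually_mem_polyhedron h.1 (u := u) fun i hi => (hu i hi).le
  have h₂ := eventually_mem_polyhedron h.1 (u := -u) fun i hi => by
    rw [dotProduct_neg, hu i hi, neg_zero]
  obtain ⟨s, h₁, h₂, hs : 0 < s⟩ := (h₁.and (h₂.and self_mem_nhdsWithin)).exists
  have h₃ := h.2 _ h₁ (by simp [hs.ne', hne])
  have h₄ := h.2 _ h₂ (by simp [hs.ne', hne])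
  simp only [dotProduct_add, dotProduct_smul, dotProduct_neg, smul_eq_mul] at h₃ h₄
  linarith

theorem span_eq_top_of_forall_dotProduct {W : Submodule ℝ (Fin d → ℝ)}
    (h : ∀ u, (∀ w ∈ W, w ⬝ᵥ u = 0) → u = 0) : W = ⊤ := by
  by_contra hW
  obtain ⟨f, hf, hWf⟩ := Submodule.exists_le_ker_of_lt_top W (lt_top_iff_ne_top.mpr hW)
  have hdot : ∀ v, f v = v ⬝ᵥ fun j => f (Pi.single j 1) := fun v => by
    rw [LinearMap.pi_apply_eq_sum_univ f v]
    refine Finset.sum_congr rfl fun j _ => ?_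
    rw [smul_eq_mul]
    congr 2
    ext k
    simp [Pi.single_apply, eq_comm]
  have h₀ := h _ fun w hw => (hdot w).symm.trans (hWf hw)
  refine hf (LinearMap.ext fun v => ?_)
  rw [hdot, h₀]
  simp

theorem Pinned.isVertex (h : Pinned a b x) (hx : x ∈ polyhedron a b) : IsVertex a b x := by
  classical
  obtain ⟨s, hst, -, hspan, hind⟩ := exists_linearIndepOn_extension (K := ℝ) (v := a)
    (linearIndepOn_empty ℝ a) (Set.empty_subset {i | a i ⬝ᵥ x = b i})
  have htop : Submodule.span ℝ (a '' s) = ⊤ := by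
    refine span_eq_top_of_forall_dotProduct fun u hu => h u fun i hi => hu _ ?_
    exact hspan ⟨i, hi, rfl⟩
  have hfin : s.Finite := hind.finite_of_isNoetherian
  have : Fintype s := hfin.fintype
  refine ⟨hx, hfin.toFinset, ?_, ?_, fun i hi => hst (by simpa using hi)⟩
  · have h₁ := finrank_span_eq_card (R := ℝ) hind
    rw [← Set.image_eq_range, htop, finrank_top, Module.finrank_fin_fun] at h₁
    rw [hfin.card_toFinset, ← h₁]
  · have : LinearIndepOn ℝ a (hfin.toFinset : Set ι) := by rwa [hfin.coe_toFinset]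
    exact this

/-- In dimension `d`, the directions orthogonal to `d - 1` linearly independent vectors form a
line. -/
theorem exists_direction {T : Finset ι} (hT : LinearIndependent ℝ (fun i : T => a i))
    (hcard : T.card + 1 = d) :
    ∃ w : Fin d → ℝ, w ≠ 0 ∧ (∀ i ∈ T, a i ⬝ᵥ w = 0) ∧
      ∀ u, (∀ i ∈ T, a i ⬝ᵥ u = 0) → ∃ s : ℝ, u = s • w := by
  set M : Matrix T (Fin d) ℝ := Matrix.of fun i => a i with hM
  have hrank : M.rank = T.card := by
    rw [LinearIndependent.rank_matrix (M := M) hT, Fintype.card_coe]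
  have hker : Module.finrank ℝ (LinearMap.ker M.mulVecLin) = 1 := by
    have := M.mulVecLin.finrank_range_add_finrank_ker
    rw [← Matrix.rank, hrank, Module.finrank_fin_fun] at this
    omega
  have hmem : ∀ u, u ∈ LinearMap.ker M.mulVecLin ↔ ∀ i ∈ T, a i ⬝ᵥ u = 0 := fun u => by
    simp [funext_iff, Matrix.mulVec, hM]
  obtain ⟨w, hw, hspan⟩ := finrank_eq_one_iff'.mp hker
  refine ⟨w, by simpa using hw, (hmem _).mp w.2, fun u hu => ?_⟩
  obtain ⟨s, hs⟩ := hspan ⟨u, (hmem u).mpr hu⟩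
  exact ⟨s, by simpa using (congrArg Subtype.val hs).symm⟩

theorem exists_eq_smul {T : Finset ι} (hT : LinearIndependent ℝ (fun i : T => a i))
    (hcard : T.card + 1 = d) {w u : Fin d → ℝ} (hw₀ : w ≠ 0) (hw : ∀ i ∈ T, a i ⬝ᵥ w = 0)
    (hu : ∀ i ∈ T, a i ⬝ᵥ u = 0) : ∃ s : ℝ, u = s • w := by
  obtain ⟨w', -, -, h⟩ := exists_direction hT hcard
  obtain ⟨s, rfl⟩ := h w hw
  obtain ⟨t, rfl⟩ := h u hu
  have hs : s ≠ 0 := by rintro rfl; simp at hw₀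
  exact ⟨t / s, by rw [smul_smul, div_mul_cancel₀ _ hs]⟩

theorem polyhedron_inter_halfspace (p : Fin d → ℝ) (r : ℝ) :
    polyhedron a b ∩ {y | p ⬝ᵥ y ≤ r} = polyhedron (addNormal a p) (addBound b r) := by
  ext y
  simp only [polyhedron, Set.mem_inter_iff, Set.mem_ofPred_eq, Option.forall, addNormal, addBound]
  tauto

/-- A constraint that is not tight at the unique maximizer can be dropped. -/
theorem IsUniqueMax.of_inter {c p : Fin d → ℝ} {r : ℝ}
    (h : IsUniqueMax c (polyhedron a b ∩ {y | p ⬝ᵥ y ≤ r}) x) (hr : p ⬝ᵥ x < r) :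
    IsUniqueMax c (polyhedron a b) x := by
  refine ⟨h.1.1, fun y hy hne => ?_⟩
  -- a point `x + s (y - x)` near `x` satisfies the dropped constraint
  obtain ⟨s, hs₀, hs₁, hs⟩ : ∃ s : ℝ, 0 < s ∧ s ≤ 1 ∧ p ⬝ᵥ (x + s • (y - x)) ≤ r := by
    obtain ⟨s, hs, hs', hs''⟩ := ((eventually_dotProduct_lt (u := y - x) hr).and
      (Ioo_mem_nhdsGT (zero_lt_one' ℝ))).exists
    exact ⟨s, hs', hs''.le, hs.le⟩
  have hmem : x + s • (y - x) ∈ polyhedron a b := fun i => by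
    have h₁ := h.1.1 i
    have h₂ := hy i
    simp only [dotProduct_add, dotProduct_smul, dotProduct_sub, smul_eq_mul]
    nlinarith
  have := h.2 _ ⟨hmem, hs⟩ (by simp [hs₀.ne', sub_eq_zero, hne])
  simp only [dotProduct_add, dotProduct_smul, dotProduct_sub, smul_eq_mul] at this
  nlinarith

theorem IsUniqueMax.eq {c y : Fin d → ℝ} {K : Set (Fin d → ℝ)} (hx : IsUniqueMax c K x)
    (hy : IsUniqueMax c K y) : x = y := by
  by_contra h
  exact lt_asymm (hx.2 y hy.1 (Ne.symm h)) (hy.2 x hx.1 h)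

end Polyhedra

/-! ### Edges and their interior points -/

section Edges

open Filter Topology

variable {m d N : ℕ} {A : Fin m → Fin d → ℝ} {b : Fin m → ℝ} {x y z w : Fin d → ℝ}

/-- The set of the constraints that are tight at `z`. -/
def active (A : Fin m → Fin d → ℝ) (b : Fin m → ℝ) (z : Fin d → ℝ) : Finset (Fin m) :=
  {i | A i ⬝ᵥ z = b i}

@[simp] theorem mem_active {i : Fin m} : i ∈ active A b z ↔ A i ⬝ᵥ z = b i := by simp [active]

/-- The point `z` lies in the relative interior of an edge: exactly `d - 1` constraints are tight
at it. -/
def IsEdgePoint (A : Fin m → Fin d → ℝ) (b : Fin m → ℝ) (z : Fin d → ℝ) : Prop :=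
  z ∈ polyhedron A b ∧ (active A b z).card + 1 = d

/-- The points that may be observed as solutions: relatively interior points of edges, and vertices
(the latter in the form `Pinned`). -/
def IsObservable (A : Fin m → Fin d → ℝ) (b : Fin m → ℝ) (z : Fin d → ℝ) : Prop :=
  IsEdgePoint A b z ∨ z ∈ polyhedron A b ∧ Pinned A b z

theorem IsObservable.mem (h : IsObservable A b z) : z ∈ polyhedron A b := h.elim And.left And.left

/-- The assumptions on the unknown polytope: it lies in the box `[-1, 1] ^ d`, its vertices have `N`
bits of precision, and any `d - 1` of its constraints are linearly independent. -/
structure WellPosed (A : Fin m → Fin d → ℝ) (b : Fin m → ℝ) (N : ℕ) : Prop where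
  box : ∀ y ∈ polyhedron A b, ‖y‖ ≤ 1
  precision : ∀ v, IsVertex A b v → HasPrecision N v
  indep : ∀ S : Finset (Fin m), S.card + 1 = d → LinearIndependent ℝ (fun i : S => A i)

/-- The solution of a day is a relatively interior point of an edge that the new hyperplane crosses
transversally, unless the new constraint is not tight; then it is the optimum over the unknown
polytope. -/
theorem solution_cases {c p : Fin d → ℝ} {r : ℝ}
    (hmax : IsUniqueMax c (polyhedron A b ∩ {y | p ⬝ᵥ y ≤ r}) x)
    (htight : ∀ v, IsVertex (addNormal A p) (addBound b r) v →
      {i | addNormal A p i ⬝ᵥ v = addBound b r i}.ncard = d) :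
    (p ⬝ᵥ x = r ∧ IsEdgePoint A b x ∧
      ∀ u, (∀ i ∈ active A b x, A i ⬝ᵥ u = 0) → p ⬝ᵥ u = 0 → u = 0) ∨
    (p ⬝ᵥ x < r ∧ Pinned A b x ∧ (active A b x).card = d ∧ IsUniqueMax c (polyhedron A b) x) := by
  have hP := hmax.1.1
  have hmax' := hmax
  rw [polyhedron_inter_halfspace] at hmax'
  have hpin := hmax'.pinned
  have hcard := htight x (hpin.isVertex hmax'.1)
  rcases (show p ⬝ᵥ x ≤ r from hmax.1.2).eq_or_lt with hr | hr
  · left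
    have hset : {i | addNormal A p i ⬝ᵥ x = addBound b r i}
        = insert none (some '' (active A b x : Set (Fin m))) := by
      ext i
      cases i <;> simp [addNormal, addBound, hr]
    rw [hset, Set.ncard_insert_of_notMem (by simp),
      Set.ncard_image_of_injective _ (Option.some_injective _), Set.ncard_coe_finset] at hcard
    refine ⟨hr, ⟨hP, hcard⟩, fun u hu hpu => hpin u fun i hi => ?_⟩
    cases i with
    | none => exact hpu
    | some i => exact hu i (mem_active.mpr hi)
  · have hset : {i | addNormal A p i ⬝ᵥ x = addBound b r i}
        = some '' (active A b x : Set (Fin m)) := by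
      ext i
      cases i <;> simp [addNormal, addBound, hr.ne]
    rw [hset, Set.ncard_image_of_injective _ (Option.some_injective _),
      Set.ncard_coe_finset] at hcard
    exact .inr ⟨hr, (hmax.of_inter hr).pinned, hcard, hmax.of_inter hr⟩

/-- The constraints that are tight at a point strictly between two feasible points are tight at
both of them. -/
theorem active_subset_of_between (hx : x ∈ polyhedron A b) (hy : y ∈ polyhedron A b) {s : ℝ}
    (hs₀ : 0 < s) (hs₁ : s < 1) {i : Fin m} (hi : i ∈ active A b (x + s • (y - x))) :
    i ∈ active A b x ∧ A i ⬝ᵥ (y - x) = 0 := by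
  rw [mem_active] at hi ⊢
  have h₁ := hx i
  have h₂ := hy i
  simp only [dotProduct_add, dotProduct_smul, dotProduct_sub, smul_eq_mul] at hi ⊢
  constructor <;> nlinarith

/-- A point strictly between two feasible points is not a vertex, so that it lies in the relative
interior of an edge, and this edge lies on the line through the two points. -/
theorem exists_isEdgePoint_of_between (hx : x ∈ polyhedron A b) (hy : y ∈ polyhedron A b)
    (hxy : x ≠ y) {s : ℝ} (hs₀ : 0 < s) (hs₁ : s < 1)
    (hz : IsObservable A b (x + s • (y - x))) :
    ∃ q, IsEdgePoint A b q ∧ ∀ i, i ∈ active A b q ↔ i ∈ active A b x ∧ A i ⬝ᵥ (y - x) = 0 := by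
  have hsub := fun i => active_subset_of_between (i := i) hx hy hs₀ hs₁
  rcases hz with hz | ⟨-, hz⟩
  · refine ⟨_, hz, fun i => ⟨hsub i, fun ⟨h₁, h₂⟩ => ?_⟩⟩
    rw [mem_active] at h₁ ⊢
    rw [dotProduct_add, dotProduct_smul, h₂, h₁, smul_zero, add_zero]
  · refine absurd (hz (y - x) fun i hi => (hsub i (mem_active.mpr hi)).2) ?_
    rwa [sub_eq_zero, eq_comm]

/-- Three different observable points on a line determine an edge: it is the edge that contains the
middle one in its relative interior. -/
theorem exists_isEdgePoint_of_collinear (hx : IsObservable A b x) (hy : IsObservable A b y)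
    (hz : IsObservable A b z) (hxy : x ≠ y) (hxz : x ≠ z) (hyz : y ≠ z) {s : ℝ}
    (hs : z = x + s • (y - x)) :
    ∃ q, IsEdgePoint A b q ∧ ∀ i, i ∈ active A b q ↔ i ∈ active A b x ∧ A i ⬝ᵥ (y - x) = 0 := by
  have hs₀ : s ≠ 0 := by rintro rfl; simp [eq_comm] at hs; exact hxz hs
  have hs₁ : s ≠ 1 := by rintro rfl; simp [eq_comm] at hs; exact hyz hs
  have hzx : z - x = s • (y - x) := by rw [hs, add_sub_cancel_left]
  have hzy : y - z = (1 - s) • (y - x) := by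
    rw [hs, sub_smul, one_smul]; abel
  rcases lt_or_gt_of_ne hs₀ with hneg | hpos
  · -- `x` lies between `z` and `y`
    have h₁ : x = z + (-s / (1 - s)) • (y - z) := by
      rw [hzy, smul_smul, div_mul_cancel₀ _ (by linarith), hs]; simp
    obtain ⟨q, hq, h⟩ := exists_isEdgePoint_of_between (s := -s / (1 - s)) hz.mem hy.mem hyz.symm
      (div_pos (by linarith) (by linarith)) (by rw [div_lt_one] <;> linarith) (h₁ ▸ hx)
    refine ⟨q, hq, fun i => (h i).trans ?_⟩
    rw [hzy, hs, dotProduct_smul, mem_active, mem_active, dotProduct_add, dotProduct_smul,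
      smul_eq_mul, smul_eq_mul, mul_eq_zero, or_iff_right (by linarith)]
    exact and_congr_left fun h => by rw [h, mul_zero, add_zero]
  · rcases lt_or_gt_of_ne hs₁ with hlt | hgt
    · exact exists_isEdgePoint_of_between hx.mem hy.mem hxy hpos hlt (hs ▸ hz)
    · -- `y` lies between `x` and `z`
      have h₁ : y = x + s⁻¹ • (z - x) := by
        rw [hzx, smul_smul, inv_mul_cancel₀ hs₀]; simp
      obtain ⟨q, hq, h⟩ := exists_isEdgePoint_of_between (s := s⁻¹) hx.mem hz.mem hxz
        (by positivity) (inv_lt_one_of_one_lt₀ hgt) (h₁ ▸ hy)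
      refine ⟨q, hq, fun i => (h i).trans ?_⟩
      rw [hzx, dotProduct_smul, smul_eq_mul, mul_eq_zero, or_iff_right hs₀]

/-- The sets of constraints that define an edge and are exactly the tight constraints at some point
of it. -/
def edgeSupports (A : Fin m → Fin d → ℝ) (b : Fin m → ℝ) : Finset (Finset (Fin m)) :=
  open Classical in {T | ∃ z, IsEdgePoint A b z ∧ active A b z = T}

theorem mem_edgeSupports {T : Finset (Fin m)} :
    T ∈ edgeSupports A b ↔ ∃ z, IsEdgePoint A b z ∧ active A b z = T := by
  simp [edgeSupports]

theorem IsEdgePoint.mem_edgeSupports (hz : IsEdgePoint A b z) :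
    active A b z ∈ edgeSupports A b := LearnEdge.mem_edgeSupports.mpr ⟨z, hz, rfl⟩

theorem IsEdgePoint.edge_mem (h : WellPosed A b N) (hz : IsEdgePoint A b z) :
    {y | ∀ i ∈ active A b z, A i ⬝ᵥ y = b i} ∩ polyhedron A b ∈ edges A b := by
  have hT := h.indep _ hz.2
  refine ⟨?_, _, hz.2, hT, rfl⟩
  obtain ⟨w, hw₀, hw, -⟩ := exists_direction hT hz.2
  obtain ⟨s, hs, hs₀ : 0 < s⟩ := ((eventually_mem_polyhedron hz.1 fun i hi =>
    (hw i (mem_active.mpr hi)).le).and self_mem_nhdsWithin).exists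
  refine ⟨z, ⟨fun i hi => mem_active.mp hi, hz.1⟩, z + s • w, ⟨fun i hi => ?_, hs⟩, ?_⟩
  · rw [dotProduct_add, dotProduct_smul, hw i hi, mem_active.mp hi, smul_zero, add_zero]
  · simp [hs₀.ne', hw₀]

theorem card_edgeSupports_le (h : WellPosed A b N) :
    (edgeSupports A b).card ≤ (edges A b).ncard := by
  have hfin : (edges A b).Finite := by
    refine (Set.finite_range fun S : Finset (Fin m) =>
      {x | ∀ i ∈ S, A i ⬝ᵥ x = b i} ∩ polyhedron A b).subset ?_
    rintro F ⟨-, S, -, -, rfl⟩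
    exact ⟨S, rfl⟩
  rw [← Set.ncard_coe_finset]
  refine Set.ncard_le_ncard_of_injOn
    (fun T => {y | ∀ i ∈ T, A i ⬝ᵥ y = b i} ∩ polyhedron A b) ?_ ?_ hfin
  · intro T hT
    obtain ⟨z, hz, rfl⟩ := mem_edgeSupports.mp hT
    exact hz.edge_mem h
  · -- a point with the tight constraints `T` shows that an edge determines `T`
    have key : ∀ T ∈ edgeSupports A b, ∀ T' : Finset (Fin m),
        {y | ∀ i ∈ T, A i ⬝ᵥ y = b i} ∩ polyhedron A b =
          {y | ∀ i ∈ T', A i ⬝ᵥ y = b i} ∩ polyhedron A b → T' ⊆ T := by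
      intro T hT T' heq i hi
      obtain ⟨z, hz, rfl⟩ := mem_edgeSupports.mp hT
      have : z ∈ {y | ∀ i ∈ active A b z, A i ⬝ᵥ y = b i} ∩ polyhedron A b :=
        ⟨fun i hi => mem_active.mp hi, hz.1⟩
      rw [heq] at this
      exact mem_active.mpr (this.1 i hi)
    intro T hT T' hT' heq
    exact (key T' hT' T heq.symm).antisymm (key T hT T' heq)

/-- Every direction along an edge ends in a vertex, and thus in a point with `N` bits of
precision. -/
theorem exists_edge_end (h : WellPosed A b N) {q : Fin d → ℝ} (hq : IsEdgePoint A b q)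
    (hw₀ : w ≠ 0) (hx : ∀ i ∈ active A b q, A i ⬝ᵥ x = b i)
    (hw : ∀ i ∈ active A b q, A i ⬝ᵥ w = 0) {f : ℝ} (hf : x + f • w ∈ polyhedron A b) :
    ∃ τ : ℝ, x + τ • w ∈ polyhedron A b ∧ (∀ t, τ < t → x + t • w ∉ polyhedron A b) ∧
      HasPrecision N (x + τ • w) := by
  have hcl : IsClosed {t : ℝ | x + t • w ∈ polyhedron A b} := by
    have : {t : ℝ | x + t • w ∈ polyhedron A b} =
        ⋂ i, {t : ℝ | A i ⬝ᵥ x + t * (A i ⬝ᵥ w) ≤ b i} := by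
      ext t
      simp [polyhedron, dotProduct_add, dotProduct_smul]
    rw [this]
    exact isClosed_iInter fun i => isClosed_le (by fun_prop) continuous_const
  have hbdd : BddAbove {t : ℝ | x + t • w ∈ polyhedron A b} := by
    obtain ⟨j, hj⟩ := Function.ne_iff.mp hw₀
    have hj' : 0 < |w j| := abs_pos.mpr hj
    refine ⟨(1 + |x j|) / |w j|, fun t ht => ?_⟩
    have h₁ := (norm_le_pi_norm (x + t • w) j).trans (h.box _ ht)
    rw [Pi.add_apply, Pi.smul_apply, smul_eq_mul, Real.norm_eq_abs] at h₁
    rw [le_div_iff₀ hj']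
    have h₂ := abs_sub_abs_le_abs_sub (t * w j) (-x j)
    rw [sub_neg_eq_add, abs_neg, add_comm _ (x j), abs_mul] at h₂
    nlinarith [le_abs_self t]
  have hgr := hcl.isGreatest_csSup ⟨f, hf⟩ hbdd
  set τ := sSup {t : ℝ | x + t • w ∈ polyhedron A b}
  have hτ : x + τ • w ∈ polyhedron A b := hgr.1
  have hend : ∀ t, τ < t → x + t • w ∉ polyhedron A b := fun t ht hmem =>
    ht.not_ge (hgr.2 hmem)
  refine ⟨τ, hτ, hend, h.precision _ (Pinned.isVertex (fun u hu => ?_) hτ)⟩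
  -- some constraint stops the movement in direction `w`
  obtain ⟨i, hi, hiw⟩ : ∃ i, A i ⬝ᵥ (x + τ • w) = b i ∧ 0 < A i ⬝ᵥ w := by
    by_contra! hno
    obtain ⟨s, hs, hs₀ : 0 < s⟩ :=
      ((eventually_mem_polyhedron hτ hno).and self_mem_nhdsWithin).exists
    rw [add_assoc, ← add_smul] at hs
    exact hend _ (by linarith) hs
  obtain ⟨s, rfl⟩ := exists_eq_smul (h.indep _ hq.2) hq.2 hw₀ hw fun i hi => hu i (by
    rw [dotProduct_add, dotProduct_smul, hw i hi, hx i hi, smul_zero, add_zero])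
  have := hu i hi
  rw [dotProduct_smul, smul_eq_mul, mul_eq_zero, or_iff_left hiw.ne'] at this
  rw [this, zero_smul]

end Edges

/-! ### Questionable intervals and their halving -/

/-- How often an interval of squared length `L` may still be halved before its squared length is
less than `1`. -/
def halvings (L : ℝ) : ℕ := if L < 1 then 0 else Nat.log 4 ⌊L⌋₊ + 1

theorem halvings_mono {L L' : ℝ} (h : L ≤ L') : halvings L ≤ halvings L' := by
  unfold halvings
  split_ifs with h₁ h₂ h₂
  · exact le_rfl
  · exact Nat.zero_le _
  · exact absurd (h.trans_lt h₂) h₁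
  · exact Nat.add_le_add_right (Nat.log_mono_right (Nat.floor_mono h)) 1

theorem halvings_lt {L L' : ℝ} (hL : 1 ≤ L) (h : 4 * L' ≤ L) : halvings L' < halvings L := by
  unfold halvings
  rw [if_neg hL.not_gt]
  split_ifs with h₁
  · exact Nat.succ_pos _
  · have h₂ : 4 ≤ ⌊L⌋₊ := Nat.le_floor (by push_cast; linarith)
    have h₃ : ⌊L'⌋₊ ≤ ⌊L⌋₊ / 4 := by
      rw [Nat.le_div_iff_mul_le (by norm_num)]
      refine Nat.le_floor ?_
      push_cast
      linarith [Nat.floor_le (show 0 ≤ L' by linarith)]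
    have h₄ := Nat.log_mono_right (b := 4) h₃
    rw [Nat.log_div_base] at h₄
    have h₅ := Nat.log_pos (by norm_num : 1 < 4) h₂
    omega

/-- The largest number of halvings on one side of an edge: the squared length of a segment in the
box `[-1, 1] ^ d` is at most `4 d`. -/
def maxHalvings (d N : ℕ) : ℕ := Nat.log 4 (4 * d * 4 ^ N) + 1

section Sides

open Cost

variable {m d N : ℕ} {A : Fin m → Fin d → ℝ} {b : Fin m → ℝ} {x w : Fin d → ℝ}

/-- The line of all points `x + s • w` contains an edge, and the constraints that define it are
exactly those that are tight at a relatively interior point of the edge. -/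
def SpansEdge (A : Fin m → Fin d → ℝ) (b : Fin m → ℝ) (x w : Fin d → ℝ) : Prop :=
  w ≠ 0 ∧ ∃ q, IsEdgePoint A b q ∧ ∀ i, i ∈ active A b q ↔ A i ⬝ᵥ x = b i ∧ A i ⬝ᵥ w = 0

theorem SpansEdge.neg (h : SpansEdge A b x w) : SpansEdge A b x (-w) := by
  obtain ⟨hw, q, hq, h⟩ := h
  exact ⟨neg_ne_zero.mpr hw, q, hq, fun i => by rw [h, dotProduct_neg, neg_eq_zero]⟩

theorem SpansEdge.dotProduct_pos (h : SpansEdge A b x w) : 0 < w ⬝ᵥ w :=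
  lt_of_le_of_ne (Finset.sum_nonneg fun j _ => mul_self_nonneg (w j))
    fun h₀ => h.1 (dotProduct_self_eq_zero.mp h₀.symm)

theorem mem_polyhedron_of_between {s t u : ℝ} (hs : x + s • w ∈ polyhedron A b)
    (hu : x + u • w ∈ polyhedron A b) (hst : s ≤ t) (htu : t ≤ u) :
    x + t • w ∈ polyhedron A b := by
  intro i
  have h₁ := hs i
  have h₂ := hu i
  simp only [dotProduct_add, dotProduct_smul, smul_eq_mul] at h₁ h₂ ⊢
  rcases le_total 0 (A i ⬝ᵥ w) with h | h <;> nlinarith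

namespace Side

/-- The squared length of the questionable interval, in units of `2⁻ᴺ`. -/
def size (N : ℕ) (w : Fin d → ℝ) (S : Side) : ℝ :=
  (S.infeas - S.feas) * (S.infeas - S.feas) * (w ⬝ᵥ w) * 2 ^ N * 2 ^ N

/-- The number of times that the questionable interval may still be halved. -/
def level (N : ℕ) (w : Fin d → ℝ) (S : Side) : ℕ := halvings (S.size N w)

/-- What a side claims about the points `x + t • w` is true. -/
structure Sound (A : Fin m → Fin d → ℝ) (b : Fin m → ℝ) (x w : Fin d → ℝ) (S : Side) : Prop where
  feas_mem : x + S.feas • w ∈ polyhedron A b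
  not_mem : ∀ t, S.infeas < t → x + t • w ∉ polyhedron A b
  not_mem_of_closed : S.closed = true → x + S.infeas • w ∉ polyhedron A b

/-- A questionable interval is empty if it is shorter than `2⁻ᴺ`. -/
def Settled (N : ℕ) (w : Fin d → ℝ) (S : Side) : Prop := S.size N w < 1 → S.feas = S.infeas

variable {S : Side}

theorem Sound.feas_le_infeas (h : S.Sound A b x w) : S.feas ≤ S.infeas := by
  by_contra hlt
  exact h.not_mem _ (not_le.mp hlt) h.feas_mem

theorem Sound.le_infeas (h : S.Sound A b x w) {t : ℝ} (ht : x + t • w ∈ polyhedron A b) :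
    t ≤ S.infeas := by
  by_contra hlt
  exact h.not_mem _ (not_le.mp hlt) ht

theorem Sound.not_mem_of_excludes (h : S.Sound A b x w) {t : ℝ} (ht : (S.excludes t).val = true) :
    x + t • w ∉ polyhedron A b := by
  unfold excludes at ht
  split_ifs at ht with hc
  · rcases (of_decide_eq_true ht : S.infeas ≤ t).eq_or_lt with rfl | hlt
    · exact h.not_mem_of_closed hc
    · exact h.not_mem t hlt
  · exact h.not_mem t (of_decide_eq_true ht)

/-- If the questionable interval is shorter than `2⁻ᴺ`, rounding up the coordinates of its lower
corner yields the only point in it with `N` bits of precision. -/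
theorem round_eq {f i τ : ℝ} (hf : f ≤ τ) (hi : τ ≤ i)
    (hlt : (i - f) * (i - f) * (w ⬝ᵥ w) * 2 ^ N * 2 ^ N < 1) (hτ : HasPrecision N (x + τ • w))
    (j : Fin d) :
    (⌈Min.min ((x + f • w) j) ((x + i • w) j) * 2 ^ N⌉ : ℝ) / 2 ^ N = (x + τ • w) j := by
  obtain ⟨k, hk⟩ := hτ j
  have h2 : (0 : ℝ) < 2 ^ N := by positivity
  have hv : (x + τ • w) j * 2 ^ N = k := by rw [hk, div_mul_cancel₀ _ h2.ne']
  have hww : w j * w j ≤ w ⬝ᵥ w :=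
    Finset.single_le_sum (f := fun j => w j * w j) (fun j _ => mul_self_nonneg (w j))
      (Finset.mem_univ j)
  -- the interval has length less than `1` in coordinate `j`, in units of `2⁻ᴺ`
  have habs : |(i - f) * w j * 2 ^ N| < 1 := by
    rw [← sq_lt_one_iff_abs_lt_one]
    refine lt_of_le_of_lt ?_ hlt
    have := mul_le_mul_of_nonneg_left hww (mul_nonneg (sq_nonneg (i - f)) (sq_nonneg (2 ^ N)))
    nlinarith
  have hceil : ⌈Min.min ((x + f • w) j) ((x + i • w) j) * 2 ^ N⌉ = k := by
    rw [Int.ceil_eq_iff, ← hv]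
    simp only [Pi.add_apply, Pi.smul_apply, smul_eq_mul]
    obtain ⟨h₁, h₂⟩ := abs_lt.mp habs
    rcases le_total 0 (w j) with hw | hw
    · rw [min_eq_left (by nlinarith)]
      have h₃ : 0 ≤ (τ - f) * w j * 2 ^ N := by
        have := mul_nonneg (sub_nonneg.mpr hf) hw
        positivity
      have h₄ : 0 ≤ (i - τ) * w j * 2 ^ N := by
        have := mul_nonneg (sub_nonneg.mpr hi) hw
        positivity
      constructor <;> linarith
    · rw [min_eq_right (by nlinarith)]
      have h₃ : 0 ≤ (τ - f) * -w j * 2 ^ N := by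
        have := mul_nonneg (sub_nonneg.mpr hf) (neg_nonneg.mpr hw)
        positivity
      have h₄ : 0 ≤ (i - τ) * -w j * 2 ^ N := by
        have := mul_nonneg (sub_nonneg.mpr hi) (neg_nonneg.mpr hw)
        positivity
      constructor <;> linarith
  rw [hceil, hk]

/-- Settling is sound: a questionable interval shorter than `2⁻ᴺ` contains the end of the edge, which
is a vertex and thus the only point of the interval with `N` bits of precision. -/
theorem settle_spec (h : WellPosed A b N) (hxw : SpansEdge A b x w) (hS : S.Sound A b x w) :
    (S.settle N x w).val.Sound A b x w ∧ (S.settle N x w).val.Settled N w ∧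
      (S.settle N x w).val.size N w ≤ S.size N w := by
  by_cases hlt : S.size N w < 1
  · obtain ⟨q, hq, hqi⟩ := hxw.2
    obtain ⟨τ, hτ, hend, hprec⟩ := exists_edge_end h hq hxw.1 (fun i hi => ((hqi i).mp hi).1)
      (fun i hi => ((hqi i).mp hi).2) hS.feas_mem
    have hf : S.feas ≤ τ := not_lt.mp fun h => hend _ h hS.feas_mem
    have hround := round_eq hf (hS.le_infeas hτ) hlt hprec
    have hval : (S.settle N x w).val = ⟨τ, τ, false⟩ := by
      simp only [settle, val_bind]
      split_ifs with hb
      swap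
      · exact absurd (decide_eq_true hlt) hb
      simp only [val_bind, val_pure, val_pointAt, val_vsub, val_dot, tabulate, val_min, mul, ceil,
        div, hround]
      have : (fun j => (x + τ • w) j) - x = τ • w := by ext j; simp
      rw [this, smul_dotProduct, smul_eq_mul, mul_div_cancel_right₀ _ hxw.dotProduct_pos.ne']
    rw [hval]
    refine ⟨⟨hτ, hend, by simp⟩, fun _ => rfl, ?_⟩
    have := mul_self_nonneg (S.infeas - S.feas)
    have := hxw.dotProduct_pos
    simp only [size, sub_self, zero_mul]
    positivity
  · have hval : (S.settle N x w).val = S := by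
      simp only [settle, val_bind]
      split_ifs with hb
      · exact absurd (of_decide_eq_true hb) hlt
      · rfl
    rw [hval]
    exact ⟨hS, fun h => absurd h hlt, le_rfl⟩

/-- The invariant of a side of a learned edge-space. -/
structure Good (A : Fin m → Fin d → ℝ) (b : Fin m → ℝ) (N : ℕ) (x w : Fin d → ℝ) (S : Side) :
    Prop where
  sound : S.Sound A b x w
  settled : S.Settled N w
  level_le : S.level N w ≤ maxHalvings d N

theorem Good.settle (h : WellPosed A b N) (hxw : SpansEdge A b x w) (hS : S.Sound A b x w)
    (hle : S.level N w ≤ maxHalvings d N) : (S.settle N x w).val.Good A b N x w := by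
  obtain ⟨h₁, h₂, h₃⟩ := settle_spec h hxw hS
  exact ⟨h₁, h₂, (halvings_mono h₃).trans hle⟩

theorem size_mono {S' : Side} (h : S'.feas ≤ S'.infeas)
    (hle : S'.infeas - S'.feas ≤ S.infeas - S.feas) : S'.size N w ≤ S.size N w := by
  have hw : 0 ≤ w ⬝ᵥ w := Finset.sum_nonneg fun j _ => mul_self_nonneg (w j)
  have h₀ : 0 ≤ S'.infeas - S'.feas := sub_nonneg.mpr h
  have h₁ : 0 ≤ S.infeas - S.feas := h₀.trans hle
  unfold size
  gcongr

theorem four_size_le {S' : Side} (h : S'.feas ≤ S'.infeas)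
    (hle : 2 * (S'.infeas - S'.feas) ≤ S.infeas - S.feas) : 4 * S'.size N w ≤ S.size N w := by
  have hw : 0 ≤ w ⬝ᵥ w := Finset.sum_nonneg fun j _ => mul_self_nonneg (w j)
  have h₀ : 0 ≤ 2 * (S'.infeas - S'.feas) := by linarith
  have h₁ : 0 ≤ S.infeas - S.feas := h₀.trans hle
  unfold size
  calc _ = (2 * (S'.infeas - S'.feas)) * (2 * (S'.infeas - S'.feas)) * (w ⬝ᵥ w) * 2 ^ N * 2 ^ N := by
        ring
    _ ≤ _ := by gcongr

theorem Settled.one_le_size (hS : S.Settled N w) (h : S.feas < S.infeas) : 1 ≤ S.size N w :=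
  not_lt.mp fun hlt => h.ne (hS hlt)

/-- A feasible point beyond the midpoint of a questionable interval halves it. -/
theorem extend_spec (h : WellPosed A b N) (hxw : SpansEdge A b x w) (hS : S.Good A b N x w) {t : ℝ}
    (ht : x + t • w ∈ polyhedron A b) :
    (S.extend N x w t).val.Good A b N x w ∧ (S.extend N x w t).val.level N w ≤ S.level N w ∧
      (S.mid.val < t → (S.extend N x w t).val.level N w < S.level N w) := by
  have hti := hS.sound.le_infeas ht
  have hmid : S.mid.val = (S.feas + S.infeas) / 2 := rfl
  have hfi := hS.sound.feas_le_infeas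
  by_cases hlt : S.feas < t
  · have hval : (S.extend N x w t).val = (Side.settle N x w ⟨t, S.infeas, S.closed⟩).val := by
      have hb : (Cost.lt S.feas t).val = true := decide_eq_true hlt
      simp only [extend, val_bind]
      rw [if_pos hb]
    have hsound : Sound A b x w ⟨t, S.infeas, S.closed⟩ :=
      ⟨ht, hS.sound.not_mem, hS.sound.not_mem_of_closed⟩
    obtain ⟨-, -, h₃⟩ := settle_spec h hxw hsound
    have h₄ : size N w ⟨t, S.infeas, S.closed⟩ ≤ S.size N w := size_mono hti (by simp; linarith)
    rw [hval]
    refine ⟨Good.settle h hxw hsound ((halvings_mono h₄).trans hS.level_le),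
      halvings_mono (h₃.trans h₄), fun hm => ?_⟩
    refine halvings_lt (hS.settled.one_le_size (hlt.trans_le hti)) ?_
    refine (mul_le_mul_of_nonneg_left h₃ (by norm_num)).trans (four_size_le hti ?_)
    simp only
    linarith
  · have hval : (S.extend N x w t).val = S := by
      have hb : ¬ (Cost.lt S.feas t).val = true := fun h => hlt (of_decide_eq_true h)
      simp only [extend, val_bind]
      rw [if_neg hb, val_pure]
    rw [hval]
    exact ⟨hS, le_rfl, fun hm => absurd hm (by linarith)⟩

/-- An infeasible point in the nearer half of a questionable interval halves it. -/
theorem exclude_spec (h : WellPosed A b N) (hxw : SpansEdge A b x w) (hS : S.Good A b N x w)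
    {t : ℝ} (ht : x + t • w ∉ polyhedron A b) :
    (S.exclude N x w t).val.Good A b N x w ∧ (S.exclude N x w t).val.level N w ≤ S.level N w ∧
      (S.feas < t → t ≤ S.mid.val → (S.exclude N x w t).val.level N w < S.level N w) := by
  have hmid : S.mid.val = (S.feas + S.infeas) / 2 := rfl
  have hfi := hS.sound.feas_le_infeas
  by_cases hlt : S.feas < t ∧ t ≤ S.infeas
  · have hval : (S.exclude N x w t).val = (Side.settle N x w ⟨S.feas, t, true⟩).val := by
      have hb : (Cost.lt S.feas t).val = true := decide_eq_true hlt.1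
      have hb' : (Cost.le t S.infeas).val = true := decide_eq_true hlt.2
      simp only [exclude, val_bind]
      rw [if_pos hb, val_bind, if_pos hb']
    have hsound : Sound A b x w ⟨S.feas, t, true⟩ :=
      ⟨hS.sound.feas_mem, fun u hu hmem =>
        ht (mem_polyhedron_of_between hS.sound.feas_mem hmem hlt.1.le hu.le), fun _ => ht⟩
    obtain ⟨-, -, h₃⟩ := settle_spec h hxw hsound
    have h₄ : size N w ⟨S.feas, t, true⟩ ≤ S.size N w := size_mono hlt.1.le (by simp; linarith)
    rw [hval]
    refine ⟨Good.settle h hxw hsound ((halvings_mono h₄).trans hS.level_le),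
      halvings_mono (h₃.trans h₄), fun _ hm => ?_⟩
    refine halvings_lt (hS.settled.one_le_size (hlt.1.trans_le hlt.2)) ?_
    refine (mul_le_mul_of_nonneg_left h₃ (by norm_num)).trans (four_size_le hlt.1.le ?_)
    simp only
    linarith
  · have hval : (S.exclude N x w t).val = S := by
      simp only [exclude, val_bind]
      by_cases h₁ : S.feas < t
      · have hb : (Cost.lt S.feas t).val = true := decide_eq_true h₁
        have hb' : ¬ (Cost.le t S.infeas).val = true := fun h => hlt ⟨h₁, of_decide_eq_true h⟩
        rw [if_pos hb, val_bind, if_neg hb', val_pure]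
      · have hb : ¬ (Cost.lt S.feas t).val = true := fun h => h₁ (of_decide_eq_true h)
        rw [if_neg hb, val_pure]
    rw [hval]
    exact ⟨hS, le_rfl, fun h₁ hm => absurd ⟨h₁, by linarith⟩ hlt⟩

/-- The position at which the line leaves the box in coordinate `j`. -/
def coordEnd (x w : Fin d → ℝ) (j : Fin d) : ℝ := (if 0 < w j then 1 - x j else -1 - x j) / w j

theorem boxEnd_spec (hw : w ≠ 0) : ∃ t, (boxEnd x w).val = some t ∧
    (∀ j, w j ≠ 0 → t ≤ coordEnd x w j) ∧ ∃ j, w j ≠ 0 ∧ t = coordEnd x w j := by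
  set f : Option ℝ → Fin d → Option ℝ := fun best j =>
    if w j = 0 then best else some (match best with
      | none => coordEnd x w j
      | some t => Min.min (coordEnd x w j) t) with hf
  have hval : (boxEnd x w).val = (List.finRange d).foldl f none := by
    rw [boxEnd, val_fold]
    congr 1
    funext best j
    simp only [hf, coordEnd]
    by_cases h₀ : w j = 0
    · simp [h₀]
    · by_cases h₁ : 0 < w j <;> cases best <;> simp [h₀, h₁, val_min]
  have key : ∀ (l : List (Fin d)) (best : Option ℝ),
      (l.foldl f best = none → best = none ∧ ∀ j ∈ l, w j = 0) ∧
      ∀ t, l.foldl f best = some t → (∀ t', best = some t' → t ≤ t') ∧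
        (∀ j ∈ l, w j ≠ 0 → t ≤ coordEnd x w j) ∧
        (best = some t ∨ ∃ j, w j ≠ 0 ∧ t = coordEnd x w j) := by
    intro l
    induction l with
    | nil =>
      refine fun best => ⟨fun h => ⟨h, by simp⟩, fun t ht => ⟨fun t' ht' => ?_, by simp, .inl ht⟩⟩
      exact (Option.some_injective _ (ht.symm.trans ht')).le
    | cons j l ih =>
      intro best
      rw [List.foldl_cons]
      obtain ⟨h₁, h₂⟩ := ih (f best j)
      by_cases h₀ : w j = 0
      · have : f best j = best := by simp [hf, h₀]
        rw [this] at h₁ h₂ ⊢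
        refine ⟨fun h => ⟨(h₁ h).1, fun i hi => ?_⟩, fun t ht => ?_⟩
        · rcases List.mem_cons.mp hi with rfl | hi
          · exact h₀
          · exact (h₁ h).2 i hi
        · obtain ⟨h₃, h₄, h₅⟩ := h₂ t ht
          refine ⟨h₃, fun i hi hwi => ?_, h₅⟩
          rcases List.mem_cons.mp hi with rfl | hi
          · exact absurd h₀ hwi
          · exact h₄ i hi hwi
      · obtain ⟨u, hu, hu₁, hu₂, hu₃⟩ : ∃ u, f best j = some u ∧ (∀ t', best = some t' → u ≤ t') ∧
            u ≤ coordEnd x w j ∧ (best = some u ∨ u = coordEnd x w j) := by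
          cases best with
          | none => exact ⟨coordEnd x w j, by simp [hf, h₀], by simp, le_rfl, .inr rfl⟩
          | some t' =>
            refine ⟨Min.min (coordEnd x w j) t', by simp [hf, h₀], fun t h => ?_, min_le_left _ _,
              ?_⟩
            · cases h; exact min_le_right _ _
            · rcases min_choice (coordEnd x w j) t' with h | h <;> simp [h]
        rw [hu] at h₁ h₂ ⊢
        refine ⟨fun h => absurd (h₁ h).1 (by simp), fun t ht => ?_⟩
        obtain ⟨h₃, h₄, h₅⟩ := h₂ t ht
        have htu := h₃ u rfl
        refine ⟨fun t' ht' => htu.trans (hu₁ t' ht'), fun i hi hwi => ?_, ?_⟩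
        · rcases List.mem_cons.mp hi with rfl | hi
          · exact htu.trans hu₂
          · exact h₄ i hi hwi
        · rcases h₅ with h₅ | h₅
          · cases h₅
            exact hu₃.imp id fun h => ⟨j, h₀, h⟩
          · exact .inr h₅
  rw [hval]
  obtain ⟨h₁, h₂⟩ := key (List.finRange d) none
  cases hres : (List.finRange d).foldl f none with
  | none =>
    exact absurd (funext fun j => (h₁ hres).2 j (List.mem_finRange j)) hw
  | some t =>
    obtain ⟨-, h₄, h₅⟩ := h₂ t hres
    exact ⟨t, rfl, fun j => h₄ j (List.mem_finRange j), h₅.resolve_left (by simp)⟩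

/-- The initial questionable interval lies in the box, which bounds the number of its halvings. -/
theorem init_good (h : WellPosed A b N) (hxw : SpansEdge A b x w) {f : ℝ}
    (hf : x + f • w ∈ polyhedron A b) : (Side.init N x w f).val.Good A b N x w := by
  obtain ⟨t, ht, hle, j₀, hj₀, htj⟩ := boxEnd_spec (x := x) hxw.1
  have hval : (Side.init N x w f).val = (Side.settle N x w ⟨f, t, false⟩).val := by
    simp only [Side.init, val_bind, ht, Option.getD_some]
  have hbox : ∀ s, x + s • w ∈ polyhedron A b → ∀ j, |x j + s * w j| ≤ 1 := fun s hs j => by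
    have := (norm_le_pi_norm (x + s • w) j).trans (h.box _ hs)
    simpa [Real.norm_eq_abs] using this
  have hsound : Sound A b x w ⟨f, t, false⟩ := by
    refine ⟨hf, fun s (hs : t < s) hmem => ?_, by simp⟩
    obtain ⟨h₁, h₂⟩ := abs_le.mp (hbox s hmem j₀)
    rw [htj, coordEnd] at hs
    split_ifs at hs with h₀
    · rw [div_lt_iff₀ h₀] at hs
      linarith
    · rw [div_lt_iff_of_neg (lt_of_le_of_ne (not_lt.mp h₀) hj₀)] at hs
      linarith
  have hft : f ≤ t := hsound.feas_le_infeas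
  rw [hval]
  refine Good.settle h hxw hsound ?_
  -- both ends of the interval lie in the box
  have hcoord : ∀ j, (t - f) * (t - f) * (w j * w j) ≤ 4 := fun j => by
    obtain ⟨h₁, h₂⟩ := abs_le.mp (hbox f hf j)
    have habs : |(t - f) * w j| ≤ 2 := by
      rcases eq_or_ne (w j) 0 with h₀ | h₀
      · simp [h₀]
      · have h₃ := hle j h₀
        unfold coordEnd at h₃
        rw [abs_le]
        split_ifs at h₃ with hpos
        · rw [le_div_iff₀ hpos] at h₃
          constructor <;> nlinarith
        · have hneg := lt_of_le_of_ne (not_lt.mp hpos) h₀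
          rw [le_div_iff_of_neg hneg] at h₃
          constructor <;> nlinarith
    have := sq_le_sq' (abs_le.mp habs).1 (abs_le.mp habs).2
    nlinarith
  have hsize : size N w ⟨f, t, false⟩ ≤ ((4 * d * 4 ^ N : ℕ) : ℝ) := by
    have hsum : (t - f) * (t - f) * (w ⬝ᵥ w) ≤ 4 * d := by
      rw [dotProduct, Finset.mul_sum]
      refine (Finset.sum_le_card_nsmul Finset.univ _ 4 fun j _ => hcoord j).trans ?_
      simp [mul_comm]
    have h4 : (4 : ℝ) ^ N = 2 ^ N * 2 ^ N := by rw [← mul_pow]; norm_num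
    unfold size
    push_cast
    rw [h4, mul_assoc]
    exact mul_le_mul_of_nonneg_right hsum (by positivity)
  refine (halvings_mono hsize).trans ?_
  unfold halvings maxHalvings
  split_ifs
  · exact Nat.zero_le _
  · rw [Nat.floor_natCast]

end Side
end Sides

/-! ### Learned edge-spaces -/

namespace EdgeSpace

open Cost

variable {m d N : ℕ} {A : Fin m → Fin d → ℝ} {b : Fin m → ℝ} {x y z p : Fin d → ℝ} {r : ℝ}
  {e : EdgeSpace d}

/-- The invariant of a learned edge-space. -/
structure Good (A : Fin m → Fin d → ℝ) (b : Fin m → ℝ) (N : ℕ) (e : EdgeSpace d) : Prop where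
  spans : SpansEdge A b e.base e.dir
  pos : e.pos.Good A b N e.base e.dir
  neg : e.neg.Good A b N e.base (-e.dir)

/-- The constraints that are tight on the whole line. -/
def support (A : Fin m → Fin d → ℝ) (b : Fin m → ℝ) (e : EdgeSpace d) : Finset (Fin m) :=
  {i | A i ⬝ᵥ e.base = b i ∧ A i ⬝ᵥ e.dir = 0}

@[simp] theorem mem_support {i : Fin m} :
    i ∈ e.support A b ↔ A i ⬝ᵥ e.base = b i ∧ A i ⬝ᵥ e.dir = 0 := by simp [support]

/-- The number of times that the two questionable intervals may still be halved. -/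
def level (N : ℕ) (e : EdgeSpace d) : ℕ := e.pos.level N e.dir + e.neg.level N (-e.dir)

theorem Good.level_le (h : e.Good A b N) : e.level N ≤ 2 * maxHalvings d N := by
  have h₁ := h.pos.level_le
  have h₂ := h.neg.level_le
  unfold level
  omega

theorem Good.exists_edgePoint (h : e.Good A b N) :
    ∃ q, IsEdgePoint A b q ∧ active A b q = e.support A b := by
  obtain ⟨-, q, hq, hi⟩ := h.spans
  exact ⟨q, hq, by ext i; rw [hi, mem_support]⟩

theorem Good.support_mem (h : e.Good A b N) : e.support A b ∈ edgeSupports A b :=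
  mem_edgeSupports.mpr h.exists_edgePoint

theorem Good.card_support (h : e.Good A b N) : (e.support A b).card + 1 = d := by
  obtain ⟨q, hq, hqe⟩ := h.exists_edgePoint
  rw [← hqe]
  exact hq.2

theorem locate_eq_some (hw : e.dir ≠ 0) {s : ℝ} :
    (e.locate x).val = some s ↔ x = e.base + s • e.dir := by
  have hww : e.dir ⬝ᵥ e.dir ≠ 0 := fun h => hw (dotProduct_self_eq_zero.mp h)
  have hval : (e.locate x).val =
      if e.base + ((x - e.base) ⬝ᵥ e.dir / (e.dir ⬝ᵥ e.dir)) • e.dir = x then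
        some ((x - e.base) ⬝ᵥ e.dir / (e.dir ⬝ᵥ e.dir)) else none := by
    simp only [locate, val_bind, val_vsub, val_dot, div, val_pointAt, val_veq, decide_eq_true_eq]
    split_ifs <;> rfl
  rw [hval]
  constructor
  · intro h
    split_ifs at h with h₁
    cases h
    exact h₁.symm
  · rintro rfl
    have : (e.base + s • e.dir - e.base) ⬝ᵥ e.dir / (e.dir ⬝ᵥ e.dir) = s := by
      rw [add_sub_cancel_left, smul_dotProduct, smul_eq_mul, mul_div_cancel_right₀ _ hww]
    rw [this, if_pos rfl]

theorem contains_eq_true (hw : e.dir ≠ 0) :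
    (e.contains x).val = true ↔ ∃ s : ℝ, x = e.base + s • e.dir := by
  simp only [contains, val_bind, val_pure, Option.isSome_iff_exists, locate_eq_some hw]

theorem Good.contains_iff (h : WellPosed A b N) (he : e.Good A b N) :
    (e.contains x).val = true ↔ e.support A b ⊆ active A b x := by
  rw [contains_eq_true he.spans.1]
  constructor
  · rintro ⟨s, rfl⟩ i hi
    rw [mem_support] at hi
    rw [mem_active, dotProduct_add, dotProduct_smul, hi.1, hi.2, smul_zero, add_zero]
  · intro hsub
    obtain ⟨s, hs⟩ := exists_eq_smul (h.indep _ he.card_support) he.card_support he.spans.1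
      (fun i hi => (mem_support.mp hi).2) (u := x - e.base) fun i hi => by
        rw [dotProduct_sub, mem_active.mp (hsub hi), (mem_support.mp hi).1, sub_self]
    exact ⟨s, by rw [← hs, add_sub_cancel]⟩

theorem Good.contains_edgePoint_iff (h : WellPosed A b N) (he : e.Good A b N)
    (hx : IsEdgePoint A b x) : (e.contains x).val = true ↔ active A b x = e.support A b := by
  rw [he.contains_iff h]
  constructor
  · intro hsub
    have h₁ := he.card_support
    have h₂ := hx.2
    exact (Finset.eq_of_subset_of_card_le hsub (by omega)).symm
  · exact fun h => h.symm.subset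

theorem Good.not_mem_of_excludes (he : e.Good A b N) (hx : (e.excludes x).val = true) :
    x ∉ polyhedron A b := by
  unfold excludes at hx
  rw [val_bind] at hx
  cases hs : (e.locate x).val with
  | none => simp [hs] at hx
  | some s =>
    rw [locate_eq_some he.spans.1] at hs
    have hx' : (e.pos.excludes s).val = true ∨ (e.neg.excludes (-s)).val = true := by
      rw [(locate_eq_some he.spans.1).mpr hs] at hx
      simpa using hx
    rcases hx' with h | h
    · rw [hs]
      exact he.pos.sound.not_mem_of_excludes h
    · have := he.neg.sound.not_mem_of_excludes h
      rwa [neg_smul_neg, ← hs] at this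

theorem cross_eq (e : EdgeSpace d) (p : Fin d → ℝ) (r : ℝ) (h : p ⬝ᵥ e.dir ≠ 0) :
    (e.cross p r).val = some (e.base + ((r - p ⬝ᵥ e.base) / (p ⬝ᵥ e.dir)) • e.dir,
      decide ((r - p ⬝ᵥ e.base) / (p ⬝ᵥ e.dir) ≤ e.pos.mid.val) &&
        decide (-((r - p ⬝ᵥ e.base) / (p ⬝ᵥ e.dir)) ≤ e.neg.mid.val)) := by
  simp only [cross, val_bind]
  split_ifs with h₀
  · exact absurd (of_decide_eq_true h₀) h
  · rfl

theorem cross_spec {fl : Bool} (h : (e.cross p r).val = some (y, fl)) :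
    ∃ s : ℝ, y = e.base + s • e.dir ∧ p ⬝ᵥ e.dir ≠ 0 ∧ p ⬝ᵥ y = r ∧
      (fl = true ↔ s ≤ e.pos.mid.val ∧ -s ≤ e.neg.mid.val) := by
  by_cases h₀ : p ⬝ᵥ e.dir = 0
  · simp only [cross, val_bind] at h
    split_ifs at h with h₁
    exact absurd (decide_eq_true h₀) h₁
  · rw [cross_eq e p r h₀] at h
    simp only [Option.some.injEq, Prod.mk.injEq] at h
    refine ⟨_, h.1.symm, h₀, ?_, ?_⟩
    · rw [← h.1, dotProduct_add, dotProduct_smul, smul_eq_mul, div_mul_cancel₀ _ h₀]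
      ring
    · rw [← h.2]
      simp

theorem exists_cross (h₀ : p ⬝ᵥ e.dir ≠ 0) {s : ℝ} (hy : y = e.base + s • e.dir)
    (hr : p ⬝ᵥ y = r) : ∃ fl, (e.cross p r).val = some (y, fl) := by
  have hs : (r - p ⬝ᵥ e.base) / (p ⬝ᵥ e.dir) = s := by
    rw [← hr, hy, dotProduct_add, dotProduct_smul, smul_eq_mul, add_sub_cancel_left,
      mul_div_cancel_right₀ _ h₀]
  rw [cross_eq e p r h₀, hs, ← hy]
  exact ⟨_, rfl⟩

@[simp] theorem support_extend : (e.extend N x).val.support A b = e.support A b := by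
  simp only [extend, val_bind]
  cases (e.locate x).val <;> rfl

@[simp] theorem support_exclude : (e.exclude N x).val.support A b = e.support A b := by
  simp only [exclude, val_bind]
  cases (e.locate x).val <;> rfl

theorem extend_of_not_mem (hx : (e.contains x).val ≠ true) : (e.extend N x).val = e := by
  simp only [contains, val_bind, val_pure, Option.isSome_iff_ne_none, ne_eq, not_not] at hx
  simp only [extend, val_bind, hx, val_pure]

theorem Good.extend (h : WellPosed A b N) (he : e.Good A b N) (hx : x ∈ polyhedron A b) :
    (e.extend N x).val.Good A b N ∧ (e.extend N x).val.level N ≤ e.level N ∧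
      ∀ s : ℝ, x = e.base + s • e.dir → ¬ (s ≤ e.pos.mid.val ∧ -s ≤ e.neg.mid.val) →
        (e.extend N x).val.level N < e.level N := by
  cases hs : (e.locate x).val with
  | none =>
    have hval : (e.extend N x).val = e := by simp only [EdgeSpace.extend, val_bind, hs, val_pure]
    rw [hval]
    refine ⟨he, le_rfl, fun s hxs => ?_⟩
    rw [(locate_eq_some he.spans.1).mpr hxs] at hs
    simp at hs
  | some s =>
    have hval : (e.extend N x).val = ⟨e.base, e.dir, (e.pos.extend N e.base e.dir s).val,
        (e.neg.extend N e.base (-e.dir) (-s)).val⟩ := by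
      simp only [EdgeSpace.extend, val_bind, hs]
      rfl
    have hxs := (locate_eq_some he.spans.1).mp hs
    obtain ⟨h₁, h₂, h₃⟩ := Side.extend_spec h he.spans he.pos (hxs ▸ hx)
    obtain ⟨h₄, h₅, h₆⟩ := Side.extend_spec h he.spans.neg he.neg (t := -s)
      (by rwa [neg_smul_neg, ← hxs])
    rw [hval]
    refine ⟨⟨he.spans, h₁, h₄⟩, Nat.add_le_add h₂ h₅, fun t ht hnot => ?_⟩
    obtain rfl : s = t :=
      Option.some_injective _ (hs.symm.trans ((locate_eq_some he.spans.1).mpr ht))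
    rcases not_and_or.mp hnot with hlt | hlt
    · exact Nat.add_lt_add_of_lt_of_le (h₃ (not_le.mp hlt)) h₅
    · exact Nat.add_lt_add_of_le_of_lt h₂ (h₆ (not_le.mp hlt))

theorem Good.exclude (h : WellPosed A b N) (he : e.Good A b N) (hx : x ∉ polyhedron A b) :
    (e.exclude N x).val.Good A b N ∧ (e.exclude N x).val.level N ≤ e.level N ∧
      ∀ s : ℝ, x = e.base + s • e.dir → s ≤ e.pos.mid.val ∧ -s ≤ e.neg.mid.val →
        (e.exclude N x).val.level N < e.level N := by
  cases hs : (e.locate x).val with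
  | none =>
    have hval : (e.exclude N x).val = e := by simp only [EdgeSpace.exclude, val_bind, hs, val_pure]
    rw [hval]
    refine ⟨he, le_rfl, fun s hxs => ?_⟩
    rw [(locate_eq_some he.spans.1).mpr hxs] at hs
    simp at hs
  | some s =>
    have hval : (e.exclude N x).val = ⟨e.base, e.dir, (e.pos.exclude N e.base e.dir s).val,
        (e.neg.exclude N e.base (-e.dir) (-s)).val⟩ := by
      simp only [EdgeSpace.exclude, val_bind, hs]
      rfl
    have hxs := (locate_eq_some he.spans.1).mp hs
    obtain ⟨h₁, h₂, h₃⟩ := Side.exclude_spec h he.spans he.pos (hxs ▸ hx)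
    obtain ⟨h₄, h₅, h₆⟩ := Side.exclude_spec h he.spans.neg he.neg (t := -s)
      (by rwa [neg_smul_neg, ← hxs])
    rw [hval]
    refine ⟨⟨he.spans, h₁, h₄⟩, Nat.add_le_add h₂ h₅, fun t ht hmid => ?_⟩
    obtain rfl : s = t :=
      Option.some_injective _ (hs.symm.trans ((locate_eq_some he.spans.1).mpr ht))
    -- an infeasible point lies beyond the feasible interval on one of the two sides
    by_cases hlt : e.pos.feas < s
    · exact Nat.add_lt_add_of_lt_of_le (h₃ hlt hmid.1) h₅
    · refine Nat.add_lt_add_of_le_of_lt h₂ (h₆ (not_le.mp fun hle => hx ?_) hmid.2)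
      have hneg := he.neg.sound.feas_mem
      rw [smul_neg, ← neg_smul] at hneg
      rw [hxs]
      exact mem_polyhedron_of_between hneg he.pos.sound.feas_mem (by linarith) (not_lt.mp hlt)

theorem good_through (h : WellPosed A b N) (hx : x ∈ polyhedron A b) (hy : y ∈ polyhedron A b)
    (hxy : SpansEdge A b x (y - x)) : (through N x y).val.Good A b N := by
  have hval : (through N x y).val = ⟨x, y - x, (Side.init N x (y - x) 1).val,
      (Side.init N x (-(y - x)) 0).val⟩ := by
    simp only [through, val_bind, val_vsub, val_vneg, val_pure]
  rw [hval]
  exact ⟨hxy, Side.init_good h hxy (by rwa [one_smul, add_sub_cancel]),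
    Side.init_good h hxy.neg (by rwa [zero_smul, add_zero])⟩

end EdgeSpace

/-! ### Learning edge-spaces -/

section Learn

open Cost

/-- A property `Q` that some step of a loop establishes and that all steps keep holds at the end. -/
theorem foldl_of_mem {α β : Type} {f : β → α → β} {l : List α} {P Q : β → Prop}
    (hP : ∀ s, ∀ a ∈ l, P s → P (f s a)) (hQ : ∀ s, ∀ a ∈ l, P s → Q s → Q (f s a)) {a₀ : α}
    (ha₀ : a₀ ∈ l) (h₀ : ∀ s, P s → Q (f s a₀)) {s : β} (hs : P s) : Q (l.foldl f s) := by
  have key : ∀ l' : List α, (∀ a ∈ l', a ∈ l) → ∀ s, P s → (Q s ∨ a₀ ∈ l') → Q (l'.foldl f s) := by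
    intro l'
    induction l' with
    | nil => exact fun _ s _ h => h.resolve_right (by simp)
    | cons a l' ih =>
      intro hl s hs h
      rw [List.foldl_cons]
      have ha := hl a (by simp)
      refine ih (fun a' h' => hl a' (by simp [h'])) _ (hP s a ha hs) ?_
      rcases h with h | h
      · exact .inl (hQ s a ha hs h)
      · rcases List.mem_cons.mp h with rfl | h
        · exact .inl (h₀ s hs)
        · exact .inr h
  exact key l (fun _ h => h) s hs (.inr ha₀)

variable {m d N : ℕ} {A : Fin m → Fin d → ℝ} {b : Fin m → ℝ} {x y z : Fin d → ℝ}
  {l : List (Fin d → ℝ)} {L : List (EdgeSpace d)}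

/-- The invariant of the list of the learned edge-spaces. -/
structure LinesGood (A : Fin m → Fin d → ℝ) (b : Fin m → ℝ) (N : ℕ) (L : List (EdgeSpace d)) :
    Prop where
  good : ∀ e ∈ L, e.Good A b N
  nodup : (L.map (EdgeSpace.support A b)).Nodup

theorem LinesGood.map (hL : LinesGood A b N L) {g : EdgeSpace d → EdgeSpace d}
    (hg : ∀ e ∈ L, (g e).Good A b N ∧ (g e).support A b = e.support A b) :
    LinesGood A b N (L.map g) := by
  refine ⟨fun e he => ?_, ?_⟩
  · obtain ⟨e', he', rfl⟩ := List.mem_map.mp he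
    exact (hg e' he').1
  · rw [List.map_map, List.map_congr_left (f := EdgeSpace.support A b ∘ g) fun e he => (hg e he).2]
    exact hL.nodup

theorem LinesGood.any_contains_iff (h : WellPosed A b N) (hL : LinesGood A b N L)
    (hx : IsEdgePoint A b x) :
    (L.any fun e => (e.contains x).val) = true ↔ active A b x ∈ L.map (EdgeSpace.support A b) := by
  simp only [List.any_eq_true, List.mem_map]
  refine exists_congr fun e => and_congr_right fun he => ?_
  rw [(hL.good e he).contains_edgePoint_iff h hx, eq_comm]

theorem val_learnStep : (learnStep N x l y L z).val =
    if x = y ∨ x = z ∨ y = z then L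
    else if ((EdgeSpace.through N x y).val.contains z).val = true ∧
        ¬ ∃ e ∈ L, (e.contains x).val = true ∧ (e.contains y).val = true then
      l.foldl (fun e y => (EdgeSpace.extend N y e).val) (EdgeSpace.through N x y).val :: L
    else L := by
  simp only [learnStep, val_bind, val_veq]
  by_cases h₁ : x = y ∨ x = z ∨ y = z
  · rw [if_pos h₁, if_pos (by simpa [or_assoc] using h₁), val_pure]
  · rw [if_neg h₁, if_neg (by simpa [or_assoc] using h₁)]
    simp only [val_bind, val_any, val_pure]
    by_cases h₂ : ((EdgeSpace.through N x y).val.contains z).val = true ∧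
        ¬ ∃ e ∈ L, (e.contains x).val = true ∧ (e.contains y).val = true
    · rw [if_pos h₂, if_pos (by simpa using h₂)]
      simp only [val_bind, val_fold, val_pure]
    · rw [if_neg h₂, if_neg (fun h => h₂ (by simpa using h)), val_pure]

theorem learnStep_spec (h : WellPosed A b N) (hx : IsObservable A b x)
    (hl : ∀ v ∈ l, IsObservable A b v) (hy : y ∈ l) (hz : z ∈ l) (hL : LinesGood A b N L) :
    LinesGood A b N (learnStep N x l y L z).val ∧ (∀ e ∈ L, e ∈ (learnStep N x l y L z).val) ∧
      (x ≠ y → x ≠ z → y ≠ z → IsEdgePoint A b x → active A b y = active A b x →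
        active A b z = active A b x →
        active A b x ∈ (learnStep N x l y L z).val.map (EdgeSpace.support A b)) := by
  rw [val_learnStep]
  split_ifs with h₁ h₂
  · exact ⟨hL, fun _ => id, fun h₂ h₃ h₄ => by simp_all⟩
  · push Not at h₁
    obtain ⟨hxy, hxz, hyz⟩ := h₁
    obtain ⟨hcoll, hold⟩ := h₂
    have hw : (EdgeSpace.through N x y).val.dir ≠ 0 := sub_ne_zero.mpr hxy.symm
    obtain ⟨s, hs⟩ := (EdgeSpace.contains_eq_true hw).mp hcoll
    obtain ⟨q, hq, hqi⟩ := exists_isEdgePoint_of_collinear hx (hl y hy) (hl z hz) hxy hxz hyz hs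
    have hspan : SpansEdge A b x (y - x) :=
      ⟨sub_ne_zero.mpr hxy.symm, q, hq, fun i => by rw [hqi, mem_active]⟩
    -- extending by feasible points preserves the invariant and the line
    have hfold : (l.foldl (fun e y => (EdgeSpace.extend N y e).val)
          (EdgeSpace.through N x y).val).Good A b N ∧
        (l.foldl (fun e y => (EdgeSpace.extend N y e).val)
          (EdgeSpace.through N x y).val).support A b = active A b q := by
      refine List.foldlRecOn (motive := fun e : EdgeSpace d =>
        e.Good A b N ∧ e.support A b = active A b q) l _
        ⟨EdgeSpace.good_through h hx.mem (hl y hy).mem hspan, ?_⟩ fun e he v hv => ?_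
      · ext i
        rw [hqi, mem_active, EdgeSpace.mem_support]
        exact Iff.rfl
      · exact ⟨(he.1.extend h (hl v hv).mem).1, by rw [EdgeSpace.support_extend]; exact he.2⟩
    set e' := l.foldl (fun e y => (EdgeSpace.extend N y e).val) (EdgeSpace.through N x y).val
    refine ⟨⟨?_, ?_⟩, fun e he => List.mem_cons_of_mem _ he, fun _ _ _ hxe hyx _ => ?_⟩
    · intro e he
      rcases List.mem_cons.mp he with rfl | he
      · exact hfold.1
      · exact hL.good e he
    · rw [List.map_cons, List.nodup_cons]
      refine ⟨fun hmem => hold ?_, hL.nodup⟩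
      obtain ⟨e, he, hee⟩ := List.mem_map.mp hmem
      have hgood := hL.good e he
      rw [hfold.2] at hee
      refine ⟨e, he, (hgood.contains_iff h).mpr ?_, (hgood.contains_iff h).mpr ?_⟩
      · exact hee.subset.trans fun i hi => ((hqi i).mp hi).1
      · refine hee.subset.trans fun i hi => ?_
        obtain ⟨h₃, h₄⟩ := (hqi i).mp hi
        rw [dotProduct_sub, mem_active.mp h₃, sub_eq_zero] at h₄
        exact mem_active.mpr h₄
    · refine List.mem_map.mpr ⟨e', List.mem_cons_self, hfold.2.trans ?_⟩
      ext i
      rw [hqi]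
      refine and_iff_left_of_imp fun hi => ?_
      rw [dotProduct_sub, mem_active.mp hi, mem_active.mp (hyx ▸ hi), sub_self]
  · refine ⟨hL, fun _ => id, fun hxy hxz hyz hxe hyx hzx => ?_⟩
    by_cases hold : ∃ e ∈ L, (e.contains x).val = true ∧ (e.contains y).val = true
    · obtain ⟨e, he, hex, -⟩ := hold
      exact List.mem_map.mpr ⟨e, he, (((hL.good e he).contains_edgePoint_iff h hxe).mp hex).symm⟩
    · -- three points with the same tight constraints are collinear
      refine absurd ⟨?_, hold⟩ h₂
      have hw : (EdgeSpace.through N x y).val.dir ≠ 0 := sub_ne_zero.mpr hxy.symm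
      rw [EdgeSpace.contains_eq_true hw]
      have hdir : ∀ v, active A b v = active A b x → ∀ i ∈ active A b x, A i ⬝ᵥ (v - x) = 0 :=
        fun v hv i hi => by
          rw [dotProduct_sub, mem_active.mp hi, mem_active.mp (hv ▸ hi), sub_self]
      obtain ⟨s, hs⟩ := exists_eq_smul (h.indep _ hxe.2) hxe.2 (sub_ne_zero.mpr hxy.symm)
        (hdir y hyx) (hdir z hzx)
      exact ⟨s, eq_add_of_sub_eq' hs⟩

/-- Learning keeps the invariant and the learned edge-spaces, and afterwards the edge of `x` is learned
if two further points of it are known. -/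
theorem learnLines_spec (h : WellPosed A b N) (hx : IsObservable A b x)
    (hl : ∀ v ∈ l, IsObservable A b v) (hL : LinesGood A b N L) :
    LinesGood A b N (learnLines N x l L).val ∧ (∀ e ∈ L, e ∈ (learnLines N x l L).val) ∧
      ∀ y ∈ l, ∀ z ∈ l, x ≠ y → x ≠ z → y ≠ z → IsEdgePoint A b x →
        active A b y = active A b x → active A b z = active A b x →
        active A b x ∈ (learnLines N x l L).val.map (EdgeSpace.support A b) := by
  set P : List (EdgeSpace d) → Prop := fun L' => LinesGood A b N L' ∧ ∀ e ∈ L, e ∈ L' with hPdef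
  have hstep : ∀ y ∈ l, ∀ L', ∀ z ∈ l, P L' → P (learnStep N x l y L' z).val :=
    fun y hy L' z hz hL' => by
      obtain ⟨h₁, h₂, -⟩ := learnStep_spec h hx hl hy hz hL'.1
      exact ⟨h₁, fun e he => h₂ e (hL'.2 e he)⟩
  have hinner : ∀ L', ∀ y ∈ l, P L' → P (l.foldl (fun L z => (learnStep N x l y L z).val) L') :=
    fun L' y hy hL' => List.foldlRecOn (motive := P) l _ hL' fun L'' h'' z hz =>
      hstep y hy L'' z hz h''
  have hval : (learnLines N x l L).val =
      l.foldl (fun L y => l.foldl (fun L z => (learnStep N x l y L z).val) L) L := by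
    rw [learnLines_eq]
    simp only [val_fold]
  rw [hval]
  have hfin := List.foldlRecOn (motive := P) l _ (⟨hL, fun _ => id⟩ : P L) fun L' h' y hy =>
    hinner L' y hy h'
  refine ⟨hfin.1, hfin.2, fun y hy z hz hxy hxz hyz hxe hyx hzx => ?_⟩
  have hkeep : ∀ y ∈ l, ∀ L', ∀ v ∈ l, P L' →
      active A b x ∈ L'.map (EdgeSpace.support A b) →
      active A b x ∈ (learnStep N x l y L' v).val.map (EdgeSpace.support A b) :=
    fun y hy L' v hv hL' hmem => by
      obtain ⟨e, he, hee⟩ := List.mem_map.mp hmem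
      exact List.mem_map.mpr ⟨e, (learnStep_spec h hx hl hy hv hL'.1).2.1 e he, hee⟩
  refine foldl_of_mem (P := P) (Q := fun L' => active A b x ∈ L'.map (EdgeSpace.support A b))
    hinner (fun L' v hv hL' hmem => ?_) hy (fun L' hL' => ?_) ⟨hL, fun _ => id⟩
  · exact (List.foldlRecOn (motive := fun L'' => P L'' ∧
      active A b x ∈ L''.map (EdgeSpace.support A b)) l _ ⟨hL', hmem⟩ fun L'' h'' z hz =>
        ⟨hstep v hv L'' z hz h''.1, hkeep v hv L'' z hz h''.1 h''.2⟩).2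
  · exact foldl_of_mem (P := P) (Q := fun L' => active A b x ∈ L'.map (EdgeSpace.support A b))
      (hstep y hy) (hkeep y hy) hz
      (fun L'' h'' => (learnStep_spec h hx hl hy hz h''.1).2.2 hxy hxz hyz hxe hyx hzx) hL'

end Learn

/-! ### The prediction -/

section Predict

open Cost

variable {d : ℕ} {c p q : Fin d → ℝ} {r : ℝ} {I : Info d}

/-- The candidates for the prediction. -/
def IsCandidate (I : Info d) (p : Fin d → ℝ) (r : ℝ) (q : Fin d → ℝ) : Prop :=
  (q ∈ I.pts ∧ p ⬝ᵥ q = r) ∨ ∃ e ∈ I.lines, ∃ fl, (e.cross p r).val = some (q, fl)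

/-- The candidates in the extended feasible region. -/
def IsExtended (I : Info d) (p : Fin d → ℝ) (r : ℝ) (q : Fin d → ℝ) : Prop :=
  (q ∈ I.pts ∧ p ⬝ᵥ q = r) ∨ ∃ e ∈ I.lines, (e.cross p r).val = some (q, true)

theorem IsCandidate.dotProduct_eq (h : IsCandidate I p r q) : p ⬝ᵥ q = r := by
  rcases h with h | ⟨e, -, fl, h⟩
  · exact h.2
  · obtain ⟨-, -, -, h, -⟩ := EdgeSpace.cross_spec h
    exact h

theorem IsExtended.isCandidate (h : IsExtended I p r q) : IsCandidate I p r q :=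
  h.imp_right fun ⟨e, he, h⟩ => ⟨e, he, true, h⟩

/-- As soon as there is a candidate that is not known to be infeasible, the prediction is the best
candidate in the extended feasible region or, in case there is none, the worst candidate. -/
theorem predictUnknown_spec (hq : IsCandidate I p r q)
    (hex : ∀ e ∈ I.lines, (e.excludes q).val ≠ true) :
    (IsExtended I p r (predictUnknown c I p r).val ∧
      ∀ z, IsExtended I p r z → c ⬝ᵥ z ≤ c ⬝ᵥ (predictUnknown c I p r).val) ∨
    ((∀ z, ¬ IsExtended I p r z) ∧ IsCandidate I p r (predictUnknown c I p r).val ∧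
      ∀ z, IsCandidate I p r z → c ⬝ᵥ (predictUnknown c I p r).val ≤ c ⬝ᵥ z) := by
  set obs := I.pts.filter fun y => (Cost.eq (p ⬝ᵥ y) r).val with hobs
  set cr := I.lines.filterMap fun e => (e.cross p r).val with hcr
  set cand := obs ++ cr.map (fun y : (Fin d → ℝ) × Bool => y.1) with hcd
  set ext := obs ++ cr.filterMap (fun y : (Fin d → ℝ) × Bool => if y.2 then some y.1 else none)
    with hed
  have hcand : ∀ z, z ∈ cand ↔ IsCandidate I p r z := fun z => by
    simp [IsCandidate, hcd, hobs, hcr, and_or_left, exists_or]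
  have hext : ∀ z, z ∈ ext ↔ IsExtended I p r z := fun z => by
    simp [IsExtended, hed, hobs, hcr]
  have hall : cand.all
      (fun y => I.lines.any fun e => (e.excludes y).val) = false := by
    rw [List.all_eq_false]
    refine ⟨q, (hcand q).mpr hq, ?_⟩
    simpa using hex
  have hval : (predictUnknown c I p r).val =
      (match cand.all (fun y => I.lines.any fun e => (e.excludes y).val),
        cand with
      | false, y :: l =>
        (match ext with
        | z :: l' => argmax c z l'
        | [] => argmin c y l)
      | _, _ => do
        let g ← dot p p
        let h ← sub r g
        let s ← div h g
        pointAt (fun _ => 0) p s).val := by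
    simp only [predictUnknown, val_bind, val_filter, val_filterMap, val_map, val_append, val_all,
      val_any, val_dot, val_pure]
    rw [← hobs, ← hcr, ← hcd, hall]
    cases cand with
    | nil => rfl
    | cons y l =>
      simp only [val_bind, val_filterMap, val_append, val_pure]
      rw [← hed]
  rw [hval, hall]
  have hmem := (hcand q).mpr hq
  cases hc : cand with
  | nil => simp [hc] at hmem
  | cons y l =>
    rw [hc] at hcand
    simp only
    cases he : ext with
    | nil =>
      obtain ⟨h₁, h₂⟩ := argmin_spec c y l
      refine .inr ⟨fun z hz => ?_, (hcand _).mp h₁, fun z hz => h₂ z ((hcand z).mpr hz)⟩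
      have := (hext z).mpr hz
      simp [he] at this
    | cons z l' =>
      rw [he] at hext
      obtain ⟨h₁, h₂⟩ := argmax_spec c z l'
      exact .inl ⟨(hext _).mp h₁, fun z hz => h₂ z ((hext z).mpr hz)⟩

end Predict

/-! ### The update -/

section Update

open Cost

variable {d : ℕ} {c p x y : Fin d → ℝ} {r : ℝ} {I : Info d} {N : ℕ}

theorem val_update_of_slack (hr : p ⬝ᵥ x ≠ r) :
    (update c N I p r y x).val =
      let L := (learnLines N x I.pts (I.lines.map fun e => (e.extend N x).val)).val
      ⟨I.pts.filter fun z => !(L.any fun e => (e.contains z).val), some x, L⟩ := by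
  simp only [update, val_bind]
  have hb : (Cost.eq (dot p x).val r).val = false := decide_eq_false hr
  rw [hb, if_pos Bool.not_false]
  simp only [val_bind, val_filter, val_map, val_pure, val_any]

theorem val_update_of_new (hr : p ⬝ᵥ x = r)
    (hline : (I.lines.any fun e => (e.contains x).val) = false) (hseen : x ∉ I.pts) :
    (update c N I p r y x).val =
      let L := (learnLines N x (I.opt.toList ++ I.pts)
        (I.lines.map fun e => (e.extend N x).val)).val
      ⟨(x :: I.pts).filter fun z => !(L.any fun e => (e.contains z).val), I.opt, L⟩ := by
  simp only [update, val_bind]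
  have hb : (Cost.eq (dot p x).val r).val = true := decide_eq_true hr
  have hs : (any (fun z => veq z x) I.pts).val = false := by
    rw [val_any, List.any_eq_false]
    intro z hz
    rw [val_veq, decide_eq_true_eq]
    rintro rfl
    exact hseen hz
  rw [hb, val_any, hline, hs, if_neg (by simp), if_pos (show (!false && !false) = true from rfl)]
  cases hI : I.opt <;> simp only [val_bind, val_filter, val_map, val_pure, val_any,
    Option.toList_none, Option.toList_some, List.nil_append, List.cons_append]

theorem val_update_of_old (hr : p ⬝ᵥ x = r)
    (h : (I.lines.any fun e => (e.contains x).val) = true ∨ x ∈ I.pts) :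
    (update c N I p r y x).val = ⟨I.pts, I.opt, I.lines.map fun e =>
      if c ⬝ᵥ x ≤ c ⬝ᵥ y then ((e.extend N x).val.exclude N y).val else (e.extend N x).val⟩ := by
  simp only [update, val_bind]
  have hb : (Cost.eq (dot p x).val r).val = true := decide_eq_true hr
  have hn : ¬ ((!(any (fun e : EdgeSpace d => e.contains x) I.lines).val &&
      !(any (fun z => veq z x) I.pts).val) = true) := by
    rcases h with h | h
    · rw [val_any, h]
      simp
    · have : (any (fun z => veq z x) I.pts).val = true := by
        rw [val_any]
        exact List.any_eq_true.mpr ⟨x, h, by simp⟩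
      rw [this]
      simp
  rw [hb, if_neg (by simp), if_neg hn]
  simp only [val_bind]
  by_cases hc : c ⬝ᵥ x ≤ c ⬝ᵥ y
  · have hb : (Cost.le (dot c x).val (dot c y).val).val = true := decide_eq_true hc
    simp only [if_pos hb, if_pos hc, val_bind, val_map, val_pure, List.map_map]
    rfl
  · have hb : ¬ (Cost.le (dot c x).val (dot c y).val).val = true := fun h =>
      hc (of_decide_eq_true h)
    simp only [if_neg hb, if_neg hc, val_map, val_pure]

end Update

/-! ### The potential -/

section Potential

open Cost

variable {m d N : ℕ} {A : Fin m → Fin d → ℝ} {b : Fin m → ℝ} {c x y z : Fin d → ℝ} {I I' : Info d}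
  {T : Finset (Fin m)}

/-- The invariant of the learner. -/
structure Info.Good (A : Fin m → Fin d → ℝ) (b : Fin m → ℝ) (c : Fin d → ℝ) (N : ℕ) (I : Info d) :
    Prop where
  edgePoint : ∀ z ∈ I.pts, IsEdgePoint A b z
  nodup : I.pts.Nodup
  not_learned : ∀ z ∈ I.pts, active A b z ∉ I.lines.map (EdgeSpace.support A b)
  no_triple : ∀ x ∈ I.pts, ∀ y ∈ I.pts, ∀ z ∈ I.pts, x ≠ y → x ≠ z → y ≠ z →
    active A b y = active A b x → active A b z = active A b x → False
  lines : LinesGood A b N I.lines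
  opt : ∀ z, I.opt = some z → IsUniqueMax c (polyhedron A b) z ∧ Pinned A b z

/-- The observed solutions that lie on no learned edge-space and have the tight constraints `T`. -/
def Info.ptsOn (A : Fin m → Fin d → ℝ) (b : Fin m → ℝ) (I : Info d) (T : Finset (Fin m)) :
    Finset (Fin d → ℝ) :=
  I.pts.toFinset.filter fun z => active A b z = T

theorem Info.mem_ptsOn : z ∈ I.ptsOn A b T ↔ z ∈ I.pts ∧ active A b z = T := by
  simp [Info.ptsOn]

theorem Info.Good.card_ptsOn_le (hI : I.Good A b c N) : (I.ptsOn A b T).card ≤ 2 := by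
  by_contra! hlt
  obtain ⟨x, y, z, hx, hy, hz, hxy, hxz, hyz⟩ := Finset.two_lt_card_iff.mp hlt
  rw [Info.mem_ptsOn] at hx hy hz
  exact hI.no_triple x hx.1 y hy.1 z hz.1 hxy hxz hyz (hy.2.trans hx.2.symm)
    (hz.2.trans hx.2.symm)

/-- The number of mistakes that the edge with the tight constraints `T` may still cause: each of them
halves a questionable interval of its edge-space or, before this edge-space is learned, provides a
new point of it. -/
def Info.potential (A : Fin m → Fin d → ℝ) (b : Fin m → ℝ) (N : ℕ) (I : Info d)
    (T : Finset (Fin m)) : ℕ :=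
  match I.lines.find? fun e => decide (e.support A b = T) with
  | some e => e.level N
  | none => 2 * maxHalvings d N + 3 - (I.ptsOn A b T).card

theorem potential_of_mem (hL : LinesGood A b N I.lines) {e : EdgeSpace d} (he : e ∈ I.lines) :
    I.potential A b N (e.support A b) = e.level N := by
  unfold Info.potential
  cases hf : I.lines.find? fun e' => decide (e'.support A b = e.support A b) with
  | none => simpa using List.find?_eq_none.mp hf e he
  | some e' =>
    have h₁ := List.find?_some hf
    have h₂ := List.inj_on_of_nodup_map hL.nodup (List.mem_of_find?_eq_some hf) he
      (of_decide_eq_true h₁)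
    rw [h₂]

theorem potential_of_not_mem (hT : T ∉ I.lines.map (EdgeSpace.support A b)) :
    I.potential A b N T = 2 * maxHalvings d N + 3 - (I.ptsOn A b T).card := by
  unfold Info.potential
  have : (I.lines.find? fun e => decide (e.support A b = T)) = none := by
    rw [List.find?_eq_none]
    intro e he h
    exact hT (List.mem_map.mpr ⟨e, he, of_decide_eq_true h⟩)
  rw [this]

theorem potential_le_of_learned (hI : I.Good A b c N)
    (hT : T ∈ I.lines.map (EdgeSpace.support A b)) :
    I.potential A b N T ≤ 2 * maxHalvings d N := by
  obtain ⟨e, he, rfl⟩ := List.mem_map.mp hT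
  rw [potential_of_mem hI.lines he]
  exact (hI.lines.good e he).level_le

theorem lt_potential_of_not_learned (hI : I.Good A b c N)
    (hT : T ∉ I.lines.map (EdgeSpace.support A b)) :
    2 * maxHalvings d N < I.potential A b N T := by
  rw [potential_of_not_mem hT]
  have := hI.card_ptsOn_le (T := T)
  omega

/-- The learner knows at least as much in `I'` as in `I`. -/
structure Info.Refines (A : Fin m → Fin d → ℝ) (b : Fin m → ℝ) (N : ℕ) (I I' : Info d) : Prop where
  lines : ∀ e ∈ I.lines, ∃ e' ∈ I'.lines, e'.support A b = e.support A b ∧ e'.level N ≤ e.level N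
  pts : ∀ z ∈ I.pts, z ∈ I'.pts ∨ active A b z ∈ I'.lines.map (EdgeSpace.support A b)

theorem Info.Refines.potential_le (h : I.Refines A b N I') (hI : I.Good A b c N)
    (hI' : I'.Good A b c N) : I'.potential A b N T ≤ I.potential A b N T := by
  by_cases hT : T ∈ I.lines.map (EdgeSpace.support A b)
  · obtain ⟨e, he, rfl⟩ := List.mem_map.mp hT
    obtain ⟨e', he', hsupp, hlevel⟩ := h.lines e he
    rw [potential_of_mem hI.lines he, ← hsupp, potential_of_mem hI'.lines he']
    exact hlevel
  · by_cases hT' : T ∈ I'.lines.map (EdgeSpace.support A b)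
    · exact (potential_le_of_learned hI' hT').trans (lt_potential_of_not_learned hI hT).le
    · rw [potential_of_not_mem hT, potential_of_not_mem hT']
      refine Nat.sub_le_sub_left (Finset.card_le_card fun z hz => ?_) _
      rw [Info.mem_ptsOn] at hz ⊢
      exact ⟨(h.pts z hz.1).resolve_right fun h' => hT' (hz.2 ▸ h'), hz.2⟩

theorem Info.Refines.potential_lt_of_new (h : I.Refines A b N I') (hI : I.Good A b c N)
    (hI' : I'.Good A b c N) (hx : x ∉ I.pts)
    (hT : active A b x ∉ I.lines.map (EdgeSpace.support A b))
    (hx' : x ∈ I'.pts ∨ active A b x ∈ I'.lines.map (EdgeSpace.support A b)) :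
    I'.potential A b N (active A b x) < I.potential A b N (active A b x) := by
  by_cases hT' : active A b x ∈ I'.lines.map (EdgeSpace.support A b)
  · exact (potential_le_of_learned hI' hT').trans_lt (lt_potential_of_not_learned hI hT)
  · rw [potential_of_not_mem hT, potential_of_not_mem hT']
    have hlt : (I.ptsOn A b (active A b x)).card < (I'.ptsOn A b (active A b x)).card := by
      refine Finset.card_lt_card (Finset.ssubset_iff_of_subset (fun z hz => ?_) |>.mpr
        ⟨x, Info.mem_ptsOn.mpr ⟨hx'.resolve_right hT', rfl⟩, fun h => hx (Info.mem_ptsOn.mp h).1⟩)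
      rw [Info.mem_ptsOn] at hz ⊢
      exact ⟨(h.pts z hz.1).resolve_right fun h' => hT' (hz.2 ▸ h'), hz.2⟩
    have := hI'.card_ptsOn_le (T := active A b x)
    omega

/-- The number of mistakes that may still occur. -/
def Info.total (A : Fin m → Fin d → ℝ) (b : Fin m → ℝ) (N : ℕ) (I : Info d) : ℕ :=
  (if I.opt = none then 1 else 0) + ∑ T ∈ edgeSupports A b, I.potential A b N T

theorem Info.Refines.total_lt_of_opt (h : I.Refines A b N I') (hI : I.Good A b c N)
    (hI' : I'.Good A b c N) (ho : I.opt = none) (ho' : I'.opt ≠ none) :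
    I'.total A b N < I.total A b N := by
  unfold Info.total
  rw [if_pos ho, if_neg ho']
  exact Nat.add_lt_add_of_lt_of_le one_pos
    (Finset.sum_le_sum fun T _ => h.potential_le hI hI')

theorem Info.Refines.total_lt (h : I.Refines A b N I') (hI : I.Good A b c N)
    (hI' : I'.Good A b c N) (ho : I'.opt = I.opt) (hT : T ∈ edgeSupports A b)
    (hlt : I'.potential A b N T < I.potential A b N T) : I'.total A b N < I.total A b N := by
  unfold Info.total
  rw [ho]
  have := Finset.sum_lt_sum (s := edgeSupports A b) (f := fun T => I'.potential A b N T)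
    (g := fun T => I.potential A b N T) (fun T _ => h.potential_le hI hI') ⟨T, hT, hlt⟩
  exact Nat.add_lt_add_left this _

/-! ### Every mistake decreases the potential -/

theorem good_empty : (Info.empty d).Good A b c N where
  edgePoint := by simp [Info.empty]
  nodup := by simp [Info.empty]
  not_learned := by simp [Info.empty]
  no_triple := by simp [Info.empty]
  lines := ⟨by simp [Info.empty], by simp [Info.empty]⟩
  opt := by simp [Info.empty]

theorem total_empty : (Info.empty d).total A b N ≤
    1 + (edgeSupports A b).card * (2 * maxHalvings d N + 3) := by
  unfold Info.total
  refine Nat.add_le_add (by split_ifs <;> simp) ?_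
  rw [← smul_eq_mul]
  refine Finset.sum_le_card_nsmul _ _ _ fun T _ => ?_
  rw [potential_of_not_mem (by simp [Info.empty])]
  exact Nat.sub_le _ _

/-- The information after learning edge-spaces from a new point `x`: the points `q` that remain are
those on no learned edge-space. -/
theorem good_of_learned (h : WellPosed A b N) {old q : List (Fin d → ℝ)}
    {o : Option (Fin d → ℝ)} (hI : I.Good A b c N) (hx : IsObservable A b x)
    (hold : ∀ v ∈ old, IsObservable A b v) (hsub : ∀ v ∈ I.pts, v ∈ old)
    (hq : q.Nodup) (hqe : ∀ z ∈ q, IsEdgePoint A b z ∧ (z = x ∨ z ∈ I.pts))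
    (hIq : ∀ z ∈ I.pts, z ∈ q)
    (ho : ∀ z, o = some z → IsUniqueMax c (polyhedron A b) z ∧ Pinned A b z) :
    let L := (learnLines N x old (I.lines.map fun e => (e.extend N x).val)).val
    let I' : Info d := ⟨q.filter fun z => !(L.any fun e => (e.contains z).val), o, L⟩
    I'.Good A b c N ∧ I.Refines A b N I' ∧
      ∀ z ∈ q, z ∈ I'.pts ∨ active A b z ∈ I'.lines.map (EdgeSpace.support A b) := by
  intro L I'
  have hext : ∀ e ∈ I.lines, (e.extend N x).val.Good A b N ∧
      (e.extend N x).val.support A b = e.support A b := fun e he =>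
    ⟨((hI.lines.good e he).extend h hx.mem).1, EdgeSpace.support_extend⟩
  obtain ⟨hL, hmono, hlearn⟩ := learnLines_spec h hx hold (hI.lines.map hext)
  have hmem : ∀ z, z ∈ I'.pts ↔ z ∈ q ∧ active A b z ∉ L.map (EdgeSpace.support A b) := by
    intro z
    rw [List.mem_filter]
    refine and_congr_right fun hz => ?_
    rw [← hL.any_contains_iff h (hqe z hz).1]
    simp [L]
  have hkeep : ∀ z ∈ q, z ∈ I'.pts ∨ active A b z ∈ I'.lines.map (EdgeSpace.support A b) := by
    intro z hz
    rw [hmem]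
    by_cases h' : active A b z ∈ L.map (EdgeSpace.support A b)
    · exact .inr h'
    · exact .inl ⟨hz, h'⟩
  refine ⟨⟨fun z hz => (hqe z ((hmem z).mp hz).1).1, hq.filter _, fun z hz => ((hmem z).mp hz).2,
    ?_, hL, ho⟩, ⟨fun e he => ?_, fun z hz => hkeep z (hIq z hz)⟩, hkeep⟩
  · -- three points on an edge would have led to learning its edge-space
    have key : ∀ y ∈ I'.pts, ∀ z ∈ I'.pts, x ∈ I'.pts → x ≠ y → x ≠ z → y ≠ z →
        active A b y = active A b x → active A b z = active A b x → False := by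
      intro y hy z hz hx' hxy hxz hyz hay haz
      rw [hmem] at hx' hy hz
      exact hx'.2 (hlearn y (hsub y ((hqe y hy.1).2.resolve_left hxy.symm)) z
        (hsub z ((hqe z hz.1).2.resolve_left hxz.symm)) hxy hxz hyz (hqe x hx'.1).1 hay haz)
    intro u hu v hv z hz huv huz hvz hau haz
    rcases (hqe u ((hmem u).mp hu).1).2 with rfl | hu'
    · exact key v hv z hz hu huv huz hvz hau haz
    rcases (hqe v ((hmem v).mp hv).1).2 with rfl | hv'
    · exact key u hu z hz hv huv.symm hvz huz hau.symm (haz.trans hau.symm)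
    rcases (hqe z ((hmem z).mp hz).1).2 with rfl | hz'
    · exact key u hu v hv hz huz.symm hvz.symm huv haz.symm (hau.trans haz.symm)
    exact hI.no_triple u hu' v hv' z hz' huv huz hvz hau haz
  · obtain ⟨hg, hs⟩ := hext e he
    exact ⟨_, hmono _ (List.mem_map.mpr ⟨e, he, rfl⟩), hs,
      ((hI.lines.good e he).extend h hx.mem).2.1⟩

/-- A mistake keeps the invariant and decreases the potential. -/
theorem update_spec (h : WellPosed A b N) (hI : I.Good A b c N) {p : Fin d → ℝ} {r : ℝ}
    (hmax : IsUniqueMax c (polyhedron A b ∩ {y | p ⬝ᵥ y ≤ r}) x)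
    (htight : ∀ v, IsVertex (addNormal A p) (addBound b r) v →
      {i | addNormal A p i ⬝ᵥ v = addBound b r i}.ncard = d)
    (hne : (predict c I p r).val ≠ x) :
    (update c N I p r (predict c I p r).val x).val.Good A b c N ∧
      (update c N I p r (predict c I p r).val x).val.total A b N < I.total A b N := by
  -- a known optimum that satisfies the new constraint is the solution
  have hopt : ∀ z, I.opt = some z → ¬ p ⬝ᵥ z ≤ r := by
    intro z hz hle
    have hp : (predict c I p r).val = z := by rw [val_predict, hz]; exact if_pos hle
    rw [hp] at hne
    exact lt_asymm (hmax.2 z ⟨(hI.opt z hz).1.1, hle⟩ hne)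
      ((hI.opt z hz).1.2 x hmax.1.1 hne.symm)
  have hpred : (predict c I p r).val = (predictUnknown c I p r).val := by
    rw [val_predict]
    cases hz : I.opt with
    | none => rfl
    | some z => exact if_neg (hopt z hz)
  set y := (predict c I p r).val
  rcases solution_cases hmax htight with ⟨hr, hx, htrans⟩ | ⟨hr, hpin, -, hxmax⟩
  · by_cases hcase : (I.lines.any fun e => (e.contains x).val) = true ∨ x ∈ I.pts
    · rw [val_update_of_old hr hcase]
      -- an observed solution on a learned edge-space is a crossing point, so that it is a candidate
      have hcross : x ∉ I.pts → ∃ e ∈ I.lines, ∃ s : ℝ, x = e.base + s • e.dir ∧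
          ∃ fl, (e.cross p r).val = some (x, fl) := by
        intro hseen
        obtain ⟨e, he, hex⟩ := List.any_eq_true.mp (hcase.resolve_right hseen)
        have hgood := hI.lines.good e he
        obtain ⟨s, hs⟩ := (EdgeSpace.contains_eq_true hgood.spans.1).mp hex
        have hact := (hgood.contains_edgePoint_iff h hx).mp hex
        have hpd : p ⬝ᵥ e.dir ≠ 0 := fun h₀ => hgood.spans.1
          (htrans _ (fun i hi => (EdgeSpace.mem_support.mp (hact ▸ hi)).2) h₀)
        exact ⟨e, he, s, hs, EdgeSpace.exists_cross hpd hs hr⟩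
      have hcand : IsCandidate I p r x := by
        by_cases hseen : x ∈ I.pts
        · exact .inl ⟨hseen, hr⟩
        · obtain ⟨e, he, s, -, hfl⟩ := hcross hseen
          exact .inr ⟨e, he, hfl⟩
      have hspec := predictUnknown_spec (c := c) hcand fun e he hex =>
        (hI.lines.good e he).not_mem_of_excludes hex hx.1
      rw [← hpred] at hspec
      have hycand : IsCandidate I p r y := hspec.elim (fun h => h.1.isCandidate) fun h => h.2.1
      have hyP : c ⬝ᵥ x ≤ c ⬝ᵥ y → y ∉ polyhedron A b := fun hle hmem =>
        (hmax.2 y ⟨hmem, hycand.dotProduct_eq.le⟩ hne).not_ge hle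
      set g : EdgeSpace d → EdgeSpace d := fun e =>
        if c ⬝ᵥ x ≤ c ⬝ᵥ y then ((e.extend N x).val.exclude N y).val else (e.extend N x).val with hg
      have hgspec : ∀ e ∈ I.lines, (g e).Good A b N ∧ (g e).support A b = e.support A b ∧
          (g e).level N ≤ (e.extend N x).val.level N ∧
          (e.extend N x).val.level N ≤ e.level N := by
        intro e he
        obtain ⟨h₁, h₂, -⟩ := (hI.lines.good e he).extend h hx.1
        by_cases hle : c ⬝ᵥ x ≤ c ⬝ᵥ y
        · obtain ⟨h₃, h₄, -⟩ := h₁.exclude h (hyP hle)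
          simp only [hg, if_pos hle]
          exact ⟨h₃, by simp, h₄, h₂⟩
        · simp only [hg, if_neg hle]
          exact ⟨h₁, by simp, le_rfl, h₂⟩
      -- if the solution is not in the extended feasible region, then its edge makes progress
      have hextend : ¬ IsExtended I p r x → ∃ e ∈ I.lines, (g e).level N < e.level N := by
        intro hnot
        obtain ⟨e, he, s, hs, fl, hfl⟩ := hcross fun hmem => hnot (.inl ⟨hmem, hr⟩)
        have hgood := hI.lines.good e he
        obtain ⟨s', hs', -, -, hmid⟩ := EdgeSpace.cross_spec hfl
        refine ⟨e, he, (hgspec e he).2.2.1.trans_lt ((hgood.extend h hx.1).2.2 s' hs' fun hm => ?_)⟩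
        rw [← hmid] at hm
        subst hm
        exact hnot (.inr ⟨e, he, hfl⟩)
      have hstrict : ∃ e ∈ I.lines, (g e).level N < e.level N := by
        rcases hspec with ⟨hyext, hbest⟩ | ⟨hnone, -, -⟩
        · by_cases hle : c ⬝ᵥ x ≤ c ⬝ᵥ y
          · -- the prediction is an infeasible point in the nearer half of a questionable interval
            rcases hyext with hyext | ⟨e, he, hfl⟩
            · exact absurd (hI.edgePoint y hyext.1).1 (hyP hle)
            · have hgood := hI.lines.good e he
              obtain ⟨s, hs, hpd, hpy, hmid⟩ := EdgeSpace.cross_spec hfl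
              have hxe : (e.contains x).val ≠ true := by
                intro hxe
                obtain ⟨s', hs'⟩ := (EdgeSpace.contains_eq_true hgood.spans.1).mp hxe
                obtain ⟨fl, hfl'⟩ := EdgeSpace.exists_cross hpd hs' hr
                rw [hfl] at hfl'
                exact hne (Prod.ext_iff.mp (Option.some_injective _ hfl')).1
              refine ⟨e, he, ?_⟩
              simp only [hg, if_pos hle, EdgeSpace.extend_of_not_mem hxe]
              exact (hgood.exclude h (hyP hle)).2.2 s hs (hmid.mp rfl)
          · exact hextend fun hxext => hle (hbest x hxext)
        · exact hextend (hnone x)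
      have hgood' : Info.Good A b c N ⟨I.pts, I.opt, I.lines.map g⟩ := by
        refine ⟨hI.edgePoint, hI.nodup, fun z hz => ?_, hI.no_triple,
          hI.lines.map fun e he => ⟨(hgspec e he).1, (hgspec e he).2.1⟩, hI.opt⟩
        rw [List.map_map, List.map_congr_left (f := EdgeSpace.support A b ∘ g)
          fun e he => (hgspec e he).2.1]
        exact hI.not_learned z hz
      have href : I.Refines A b N ⟨I.pts, I.opt, I.lines.map g⟩ :=
        ⟨fun e he => ⟨g e, List.mem_map.mpr ⟨e, he, rfl⟩, (hgspec e he).2.1,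
          (hgspec e he).2.2.1.trans (hgspec e he).2.2.2⟩, fun z hz => .inl hz⟩
      obtain ⟨e, he, hlt⟩ := hstrict
      refine ⟨hgood', href.total_lt hI hgood' rfl (hI.lines.good e he).support_mem ?_⟩
      rw [potential_of_mem hI.lines he, ← (hgspec e he).2.1]
      exact (potential_of_mem (I := ⟨I.pts, I.opt, I.lines.map g⟩) hgood'.lines
        (List.mem_map.mpr ⟨e, he, rfl⟩)).trans_lt hlt
    · push Not at hcase
      obtain ⟨hline, hseen⟩ := hcase
      rw [val_update_of_new hr (by simpa using hline) hseen]
      have hold : ∀ v ∈ I.opt.toList ++ I.pts, IsObservable A b v := by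
        intro v hv
        rcases List.mem_append.mp hv with hv | hv
        · obtain ⟨h₁, h₂⟩ := hI.opt v (by simpa using hv)
          exact .inr ⟨h₁.1, h₂⟩
        · exact .inl (hI.edgePoint v hv)
      have hq : ∀ z ∈ x :: I.pts, IsEdgePoint A b z ∧ (z = x ∨ z ∈ I.pts) := by
        intro z hz
        rcases List.mem_cons.mp hz with rfl | hz
        · exact ⟨hx, .inl rfl⟩
        · exact ⟨hI.edgePoint z hz, .inr hz⟩
      obtain ⟨hgood, href, hkeep⟩ := good_of_learned h hI (.inl hx) hold (fun v hv => by simp [hv])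
        (List.nodup_cons.mpr ⟨hseen, hI.nodup⟩) hq (fun z hz => by simp [hz]) hI.opt
      refine ⟨hgood, href.total_lt hI hgood rfl hx.mem_edgeSupports
        (href.potential_lt_of_new hI hgood hseen ?_ (hkeep x (by simp)))⟩
      rwa [ne_eq, hI.lines.any_contains_iff h hx] at hline
  · rw [val_update_of_slack hr.ne]
    obtain ⟨hgood, href, -⟩ := good_of_learned h (old := I.pts) (q := I.pts) (o := some x) hI
      (.inr ⟨hmax.1.1, hpin⟩) (fun v hv => .inl (hI.edgePoint v hv)) (fun v hv => hv) hI.nodup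
      (fun z hz => ⟨hI.edgePoint z hz, .inr hz⟩) (fun z hz => hz)
      (fun z hz => by cases hz; exact ⟨hxmax, hpin⟩)
    refine ⟨hgood, href.total_lt_of_opt hI hgood ?_ (by simp)⟩
    by_contra ho
    obtain ⟨z, hz⟩ := Option.ne_none_iff_exists'.mp ho
    refine hopt z hz ?_
    rw [(hI.opt z hz).1.eq hxmax]
    exact hr.le

end Potential

/-! ### Counting mistakes and steps -/

section Counting

open Cost Topology

variable {m d N : ℕ} {A : Fin m → Fin d → ℝ} {b : Fin m → ℝ} {c : Fin d → ℝ} {I : Info d}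

theorem Info.Good.length_lines_le (hI : I.Good A b c N) :
    I.lines.length ≤ (edgeSupports A b).card := by
  rw [← List.length_map (EdgeSpace.support A b), ← List.toFinset_card_of_nodup hI.lines.nodup]
  refine Finset.card_le_card fun T hT => ?_
  obtain ⟨e, he, rfl⟩ := List.mem_map.mp (List.mem_toFinset.mp hT)
  exact (hI.lines.good e he).support_mem

theorem Info.Good.length_pts_le (hI : I.Good A b c N) :
    I.pts.length ≤ 2 * (edgeSupports A b).card := by
  rw [← List.toFinset_card_of_nodup hI.nodup]
  refine (Finset.card_le_mul_card_image (f := active A b) I.pts.toFinset 2 fun T _ =>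
    hI.card_ptsOn_le).trans (Nat.mul_le_mul_left 2 (Finset.card_le_card fun T hT => ?_))
  obtain ⟨z, hz, rfl⟩ := Finset.mem_image.mp hT
  exact (hI.edgePoint z (List.mem_toFinset.mp hz)).mem_edgeSupports

/-- A potential that starts at `Φ 0` and drops at each time in `S`, never growing, bounds the size
of `S`. -/
theorem finite_and_ncard_le_of_decreasing {S : Set ℕ} {Φ : ℕ → ℕ}
    (hS : ∀ t ∈ S, Φ (t + 1) < Φ t) (hle : ∀ t, Φ (t + 1) ≤ Φ t) :
    S.Finite ∧ S.ncard ≤ Φ 0 := by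
  classical
  have key : ∀ n, ((Finset.range n).filter (· ∈ S)).card + Φ n ≤ Φ 0 := by
    intro n
    induction n with
    | zero => simp
    | succ n ih =>
      rw [Finset.range_add_one, Finset.filter_insert]
      split_ifs with h
      · rw [Finset.card_insert_of_notMem (by simp)]
        have := hS n h
        omega
      · have := hle n
        omega
  have hsub : ∀ F : Finset ℕ, (F : Set ℕ) ⊆ S → F.card ≤ Φ 0 := by
    intro F hF
    obtain ⟨n, hn⟩ := F.bddAbove
    refine (Finset.card_le_card fun t ht => ?_).trans
      ((Nat.le_add_right _ _).trans (key (n + 1)))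
    rw [Finset.mem_filter, Finset.mem_range]
    exact ⟨Nat.lt_succ_of_le (hn ht), hF ht⟩
  have hfin : S.Finite := by
    by_contra hinf
    obtain ⟨F, hF, hcard⟩ := Set.Infinite.exists_subset_card_eq hinf (Φ 0 + 1)
    have := hsub F hF
    omega
  refine ⟨hfin, ?_⟩
  rw [Set.ncard_eq_toFinset_card S hfin]
  exact hsub _ (by simp)

/-- If the polytope has an edge, the initial potential is at most a constant multiple of
`|E| N log d`. -/
theorem initial_potential_le {K E : ℕ} (hd : 2 ≤ d) (hN : 1 ≤ N) (hK : K ≤ E) (hE : 1 ≤ E) :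
    ((1 + K * (2 * maxHalvings d N + 3) : ℕ) : ℝ) ≤ 24 * E * N * Real.log d := by
  have hlog2 : 0.69 < Real.log 2 := by linarith [Real.log_two_gt_d9]
  have hlogd : Real.log 2 ≤ Real.log d := Real.log_le_log (by norm_num) (by exact_mod_cast hd)
  have hmax : maxHalvings d N = N + Nat.log 4 d + 2 := by
    have h₁ : 4 * d * 4 ^ N = d * 4 ^ (N + 1) := by ring
    unfold maxHalvings
    rw [h₁]
    have : ∀ k, Nat.log 4 (d * 4 ^ k) = Nat.log 4 d + k := by
      intro k
      induction k with
      | zero => simp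
      | succ k ih =>
        rw [pow_succ, ← mul_assoc, Nat.log_mul_base (by norm_num) (by positivity), ih]
        ring
    rw [this]
    ring
  have hlog4 : (Nat.log 4 d : ℝ) ≤ Real.log d := by
    have h₁ : ((4 ^ Nat.log 4 d : ℕ) : ℝ) ≤ d := by
      exact_mod_cast Nat.pow_log_le_self 4 (by omega)
    have h₂ := Real.log_le_log (by positivity) h₁
    push_cast at h₂
    rw [Real.log_pow] at h₂
    have h₃ : (1 : ℝ) ≤ Real.log 4 := by
      rw [show (4 : ℝ) = 2 ^ 2 by norm_num, Real.log_pow]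
      push_cast
      linarith
    nlinarith [Nat.cast_nonneg (α := ℝ) (Nat.log 4 d)]
  have hN' : (1 : ℝ) ≤ N := by exact_mod_cast hN
  have hE' : (1 : ℝ) ≤ E := by exact_mod_cast hE
  have h₀ : (1 + K * (2 * maxHalvings d N + 3) : ℕ) ≤ E * (2 * maxHalvings d N + 4) := by
    have := Nat.mul_le_mul_right (2 * maxHalvings d N + 3) hK
    rw [show E * (2 * maxHalvings d N + 4) = E + E * (2 * maxHalvings d N + 3) by ring]
    omega
  have hone : 1 ≤ 2 * Real.log d := by linarith
  have hinner : ((2 * maxHalvings d N + 4 : ℕ) : ℝ) ≤ 24 * N * Real.log d := by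
    rw [hmax]
    push_cast
    have h₁ : (N : ℝ) ≤ N * (2 * Real.log d) := le_mul_of_one_le_right (by linarith) hone
    have h₂ : Real.log d ≤ N * Real.log d := le_mul_of_one_le_left (by linarith) hN'
    linarith
  calc ((1 + K * (2 * maxHalvings d N + 3) : ℕ) : ℝ)
      ≤ ((E * (2 * maxHalvings d N + 4) : ℕ) : ℝ) := by exact_mod_cast h₀
    _ = E * ((2 * maxHalvings d N + 4 : ℕ) : ℝ) := by rw [Nat.cast_mul]
    _ ≤ E * (24 * N * Real.log d) := mul_le_mul_of_nonneg_left hinner (by linarith)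
    _ = 24 * E * N * Real.log d := by ring

/-- The polytope has an edge as soon as there is a solution: from an optimal vertex, an edge starts
when one of its tight constraints is relaxed. -/
theorem edgeSupports_nonempty (hd : 2 ≤ d) (h : WellPosed A b N) {p x : Fin d → ℝ} {r : ℝ}
    (hmax : IsUniqueMax c (polyhedron A b ∩ {y | p ⬝ᵥ y ≤ r}) x)
    (htight : ∀ v, IsVertex (addNormal A p) (addBound b r) v →
      {i | addNormal A p i ⬝ᵥ v = addBound b r i}.ncard = d) :
    (edgeSupports A b).Nonempty := by
  rcases solution_cases hmax htight with ⟨-, hx, -⟩ | ⟨-, hpin, hcard, -⟩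
  · exact ⟨_, hx.mem_edgeSupports⟩
  obtain ⟨i, hi⟩ : (active A b x).Nonempty := Finset.card_pos.mp (by omega)
  have hT : ((active A b x).erase i).card + 1 = d := by
    rw [Finset.card_erase_add_one hi, hcard]
  -- a direction along which only the constraint `i` is relaxed
  obtain ⟨u, hu, hui⟩ : ∃ u, (∀ j ∈ (active A b x).erase i, A j ⬝ᵥ u = 0) ∧ A i ⬝ᵥ u < 0 := by
    obtain ⟨w, hw₀, hw, -⟩ := exists_direction (h.indep _ hT) hT
    have hwi : A i ⬝ᵥ w ≠ 0 := fun h₀ => hw₀ (hpin w fun j hj => by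
      rcases eq_or_ne j i with rfl | hji
      · exact h₀
      · exact hw j (Finset.mem_erase.mpr ⟨hji, mem_active.mpr hj⟩))
    rcases lt_or_gt_of_ne hwi with hlt | hgt
    · exact ⟨w, hw, hlt⟩
    · refine ⟨-w, fun j hj => ?_, ?_⟩
      · rw [dotProduct_neg, hw j hj, neg_zero]
      · rw [dotProduct_neg]
        linarith
  have hle : ∀ j, A j ⬝ᵥ x = b j → A j ⬝ᵥ u ≤ 0 := fun j hj => by
    rcases eq_or_ne j i with rfl | hji
    · exact hui.le
    · exact (hu j (Finset.mem_erase.mpr ⟨hji, mem_active.mpr hj⟩)).le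
  have hslack : ∀ᶠ s in 𝓝[>] (0 : ℝ), ∀ j, A j ⬝ᵥ x < b j → A j ⬝ᵥ (x + s • u) < b j :=
    Filter.eventually_all.mpr fun j =>
      Filter.eventually_imp_distrib_left.mpr fun hj => eventually_dotProduct_lt hj
  obtain ⟨s, hmem, hs, hs₀ : 0 < s⟩ := ((eventually_mem_polyhedron hmax.1.1 hle).and
    (hslack.and self_mem_nhdsWithin)).exists
  have hact : active A b (x + s • u) = (active A b x).erase i := by
    ext j
    rw [Finset.mem_erase, mem_active, mem_active]
    constructor
    · intro hj
      have hjx : A j ⬝ᵥ x = b j := (hmax.1.1 j).eq_of_not_lt fun hlt => (hs j hlt).ne hj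
      refine ⟨?_, hjx⟩
      rintro rfl
      rw [dotProduct_add, dotProduct_smul, smul_eq_mul, hjx] at hj
      nlinarith
    · rintro ⟨hji, hj⟩
      rw [dotProduct_add, dotProduct_smul, hu j (Finset.mem_erase.mpr ⟨hji, mem_active.mpr hj⟩),
        smul_zero, add_zero, hj]
  exact ⟨_, IsEdgePoint.mem_edgeSupports ⟨hmem, by rw [hact, hT]⟩⟩

/-- The mistake bound, and the bound on the time of a day as a polynomial expression in the dimension
and the number of edges. -/
theorem mistakes_and_time_le (hd : 2 ≤ d) (hN : 1 ≤ N) (h : WellPosed A b N) {p : ℕ → Fin d → ℝ}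
    {r : ℕ → ℝ} {x : ℕ → Fin d → ℝ}
    (hmax : ∀ t, IsUniqueMax c (polyhedron A b ∩ {y | p t ⬝ᵥ y ≤ r t}) (x t))
    (htight : ∀ t v, IsVertex (addNormal A (p t)) (addBound b (r t)) v →
      {i | addNormal A (p t) i ⬝ᵥ v = addBound b (r t) i}.ncard = d) :
    {t | predictionAt c N p r x t ≠ x t}.Finite ∧
      ({t | predictionAt c N p r x t ≠ x t}.ncard : ℝ) ≤
        24 * (edges A b).ncard * N * Real.log d ∧
      ∀ t, timeAt c N p r x t ≤ dayBound d (2 * (edges A b).ncard) (edges A b).ncard := by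
  have hday : ∀ t, infoAt c N p r x (t + 1) =
      if predictionAt c N p r x t = x t then infoAt c N p r x t
      else (update c N (infoAt c N p r x t) (p t) (r t) (predictionAt c N p r x t) (x t)).val := by
    intro t
    simp only [infoAt, day, Cost.val_bind, Cost.val_veq]
    split_ifs with h₁ h₂ h₂
    · rfl
    · exact absurd (of_decide_eq_true h₁) h₂
    · exact absurd (decide_eq_true h₂) h₁
    · rfl
  have hgood : ∀ t, (infoAt c N p r x t).Good A b c N := by
    intro t
    induction t with
    | zero => exact good_empty
    | succ t ih =>
      rw [hday]
      split_ifs with hy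
      · exact ih
      · exact (update_spec h ih (hmax t) (htight t) hy).1
  have hdec : ∀ t ∈ {t | predictionAt c N p r x t ≠ x t},
      (infoAt c N p r x (t + 1)).total A b N < (infoAt c N p r x t).total A b N := by
    intro t (ht : predictionAt c N p r x t ≠ x t)
    rw [hday, if_neg ht]
    exact (update_spec h (hgood t) (hmax t) (htight t) ht).2
  have hle : ∀ t, (infoAt c N p r x (t + 1)).total A b N ≤ (infoAt c N p r x t).total A b N := by
    intro t
    by_cases ht : predictionAt c N p r x t = x t
    · rw [hday, if_pos ht]
    · exact (hdec t ht).le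
  have hK := card_edgeSupports_le h
  obtain ⟨hfin, hcard⟩ := finite_and_ncard_le_of_decreasing
    (Φ := fun t => (infoAt c N p r x t).total A b N) hdec hle
  refine ⟨hfin, ?_, fun t => ?_⟩
  · refine le_trans (by exact_mod_cast hcard.trans total_empty) (initial_potential_le hd hN hK
      ((Finset.card_pos.mpr (edgeSupports_nonempty hd h (hmax 0) (htight 0))).trans_le hK))
  · exact (time_day_le c N _ (p t) (r t) (x t)).trans ((dayBound_mono
      ((hgood t).length_pts_le.trans (Nat.mul_le_mul_left 2 hK))
      ((hgood t).length_lines_le.trans hK)))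

end Counting

end LearnEdge

end

theorem theorem1 :
    ∃ (C : ℝ) (Q : MvPolynomial (Fin 3) ℕ),
      ∀ (m d N : ℕ) (_ : 2 ≤ d) (_ : 1 ≤ N)
        (A : Fin m → Fin d → ℝ) (b : Fin m → ℝ) (c : Fin d → ℝ)
        (p : ℕ → Fin d → ℝ) (r : ℕ → ℝ) (x : ℕ → Fin d → ℝ)
        -- the new constraint of day `t` is a halfspace
        (_ : ∀ t, p t ≠ 0)
        -- on day `t`, the linear program has the unique optimal solution `x t`
        (_ : ∀ t, LearnEdge.IsUniqueMax c
          (LearnEdge.polyhedron A b ∩ {y | p t ⬝ᵥ y ≤ r t}) (x t))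
        -- the unknown polytope lies in the unit ball of the maximum norm
        (_ : ∀ y ∈ LearnEdge.polyhedron A b, ‖y‖ ≤ 1)
        -- its vertices have `N` bits of precision
        (_ : ∀ v, LearnEdge.IsVertex A b v → LearnEdge.HasPrecision N v)
        -- any `d - 1` rows of `A` have rank `d - 1`
        (_ : ∀ S : Finset (Fin m), S.card + 1 = d → LinearIndependent ℝ (fun i : S => A i))
        -- in each vertex of the polytope of day `t`, exactly `d` of its constraints are tight
        (_ : ∀ t v,
          LearnEdge.IsVertex (LearnEdge.addNormal A (p t)) (LearnEdge.addBound b (r t)) v →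
            {i | LearnEdge.addNormal A (p t) i ⬝ᵥ v = LearnEdge.addBound b (r t) i}.ncard = d),
        {t | LearnEdge.predictionAt c N p r x t ≠ x t}.Finite ∧
        ({t | LearnEdge.predictionAt c N p r x t ≠ x t}.ncard : ℝ) ≤
          C * (LearnEdge.edges A b).ncard * N * Real.log d ∧
        ∀ t, LearnEdge.timeAt c N p r x t ≤
          MvPolynomial.eval ![m, d, (LearnEdge.edges A b).ncard] Q := by
  refine ⟨24, LearnEdge.dayBound (MvPolynomial.X 1) (2 * MvPolynomial.X 2) (MvPolynomial.X 2), ?_⟩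
  intro m d N hd hN A b c p r x _ hmax hbox hprec hindep htight
  obtain ⟨hfin, hcard, htime⟩ :=
    LearnEdge.mistakes_and_time_le hd hN ⟨hbox, hprec, hindep⟩ hmax htight
  refine ⟨hfin, hcard, fun t => (htime t).trans (le_of_eq ?_)⟩
  simp [LearnEdge.dayBound, LearnEdge.predictBound, LearnEdge.updateBound, LearnEdge.learnBound]
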